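/- Throughout, sequences are indexed by $\mathbb{N}=\{1,2,\dots\}$. For $\delta\in(0,1]$, a sequence $a:\mathbb{N}\to\mathbb{R}$ is \emph{$\delta$-scattered} if there exists $\epsilon>0$ such that for every sufficiently large $N$, $$\frac1{N^2}\sum_{1\leq m<n\leq N}\min\big(|a(n)-a(m)|^{-\delta},1\big)\leq\frac1{(\log N)^{1+\epsilon}},$$ where the minimum is understood to be $1$ when $a(n)=a(m)$. The sequence $a$ is \emph{scattered} if it is $\delta$-scattered for every $\delta\in(0,1]$. Sequences $a_1,\dots,a_k:\mathbb{N}\to\mathbb{R}$ are \emph{jointly scattered} if for every non-zero $v\in\mathbb{R}^k$ the sequence $v_1a_1+\cdots+v_ka_k$ is scattered. A sequence $(x_n)_{n\in\mathbb{N}}$ in $\mathbb{R}^d$ is \emph{uniformly distributed in $\mathbb{T}^d$} (that is, modulo $1$) if for all intervals $I_1,\dots,I_d\subset[0,1]$, $$\lim_{N\to\infty}\frac1N\Big|\big\{n\in\{1,\dots,N\}:\{x_n\}\in I_1\times\cdots\times I_d\big\}\Big|=\mu(I_1\times\cdots\times I_d),$$ where $\{x_n\}$ is the vector of coordinatewise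 fractional parts of $x_n$ and $\mu$ is the $d$-dimensional Lebesgue measure. \textbf{Theorem.} Let $g:\mathbb{R}\to(1,\infty)$ be a non-constant real-analytic function and let $b:\mathbb{N}\to\mathbb{R}$ be a scattered sequence with $b(n)\to+\infty$ as $n\to\infty$. Let $k\geq1$ be an integer, let $p_1,\dots,p_k\in\mathbb{R}[x]$ be non-constant polynomials and let $a_1,\dots,a_k:\mathbb{N}\to\mathbb{R}$ be scattered sequences. Assume that either (1) the sequences $a_1,\dots,a_k$ are jointly scattered, or (2) the polynomials $1,p_1,\dots,p_k$ are linearly independent over $\mathbb{R}$. Then for Lebesgue-almost every $x\in\mathbb{R}$, the sequence $$\big(g(x)^{b(n)},\,a_1(n)p_1(x),\,\dots,\,a_k(n)p_k(x)\big)_{n\in\mathbb{N}}$$ is uniformly distributed in $\mathbb{T}^{k+1}$. -/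

import Mathlib

open MeasureTheory Filter Topology Polynomial

/-- The truncated kernel `min (t ^ (-δ), 1)` for `t ≥ 0`, with the usual convention
`0 ^ (-δ) = +∞`, so that the value at `t = 0` is `1`. -/
noncomputable def truncKernel (δ t : ℝ) : ℝ :=
  if t = 0 then 1 else min (t ^ (-δ)) 1

/-- Sequences are indexed by the positive integers: the value `a 0` is never used. -/
def DeltaScattered (δ : ℝ) (a : ℕ → ℝ) : Prop :=
  ∃ ε : ℝ, 0 < ε ∧ ∀ᶠ N : ℕ in atTop,
    1 / (N : ℝ) ^ 2 * ∑ n ∈ Finset.Icc 1 N, ∑ m ∈ Finset.Ico 1 n, truncKernel δ |a n - a m|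
      ≤ 1 / (Real.log N) ^ (1 + ε)

/-- A sequence is scattered if it is `δ`-scattered for every `δ ∈ (0, 1]`. -/
def Scattered (a : ℕ → ℝ) : Prop :=
  ∀ δ ∈ Set.Ioc (0 : ℝ) 1, DeltaScattered δ a

/-- Every nontrivial real linear combination of the sequences is scattered. -/
def JointlyScattered {k : ℕ} (a : Fin k → ℕ → ℝ) : Prop :=
  ∀ v : Fin k → ℝ, v ≠ 0 → Scattered (fun n => ∑ i, v i * a i n)

/-- Uniform distribution modulo one of a sequence `x 1, x 2, …` in `ℝ ^ k`: for all intervals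
`I i ⊆ [0, 1]` (open, closed, half-open or degenerate), the frequency with which the vector of
fractional parts lies in the box `∏ I i` tends to the Lebesgue measure of the box. -/
def UniformlyDistributedModOne {k : ℕ} (x : ℕ → Fin k → ℝ) : Prop :=
  ∀ I : Fin k → Set ℝ, (∀ i, (I i).OrdConnected ∧ I i ⊆ Set.Icc 0 1) →
    Tendsto
      (fun N : ℕ =>
        (1 / (N : ℝ)) *
          ({n : ℕ | n ∈ Set.Icc 1 N ∧
            (fun i => Int.fract (x n i)) ∈ Set.univ.pi I}.ncard : ℝ))
      atTop (𝓝 (volume (Set.univ.pi I)).toReal)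

/-! By Weyl's criterion and countability of the frequencies, it is enough to fix a nonzero integer
vector `m` and show that the averages of `exp (i φ_n(x))` tend to zero for almost every `x`, where
`φ_n` is `2π` times the pairing of `m` with the `n`-th vector. Expanding the square of the sum turns
this into a question about the integrals of `exp (i (φ_n - φ_l))` over a bounded interval. If these
are `O(min(|s n - s l|^(-δ), 1))` for a scattered `s`, the normalised mean squares are `O((log
N)^(-1-ε))`. That is summable along `N = ⌊c^j⌋`, and letting `c` decrease to `1` recovers all `N`
(`ae_tendsto_average_of_scattered`).

The integrals are bounded by van der Corput's lemma. Let `d` bound the degrees of the `p_i`, and put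
`G = log g`.

If `m 0 ≠ 0`, differentiating `d + 1` times removes the polynomials. What remains is a difference of
derivatives of `exp (b G)` at `b n` and `b l`, which is at least `|b n - b l|` where `G'` is bounded
away from zero. Thus `s = b` and `δ = 1/(d + 1)` (`exists_norm_integral_exp_exp_sub_le`). Critical
points of `g` form a null set by analyticity.

If `m 0 = 0`, the phase difference is a polynomial. Either hypothesis on the `a_i` and `p_i` makes
one of its nonconstant coefficients at least a multiple of `|s n - s l|` for some scattered `s`
(`exists_scattered_le_abs_coeff`). Uniform decay for polynomial phases then gives `δ = 1/d`
(`exists_norm_integral_exp_polynomial_le`). -/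

/-! ### Oscillatory integrals and van der Corput's lemma. -/

theorem norm_exp_I_mul_ofReal (t : ℝ) : ‖Complex.exp (Complex.I * (t : ℂ))‖ = 1 := by
  rw [mul_comm]; exact Complex.norm_exp_ofReal_mul_I t

theorem norm_integral_exp_le_length (f : ℝ → ℝ) {a b : ℝ} (hab : a ≤ b) :
    ‖∫ x in a..b, Complex.exp (Complex.I * (f x : ℂ))‖ ≤ b - a := by
  have := intervalIntegral.norm_integral_le_of_norm_le_const (a := a) (b := b) (C := 1)
    (f := fun x => Complex.exp (Complex.I * (f x : ℂ))) (fun x _ => (norm_exp_I_mul_ofReal _).le)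
  simpa [abs_of_nonneg (sub_nonneg.2 hab)] using this

/-- Integration by parts against `exp (i f)` on an interval without critical points of `f`. -/
theorem norm_integral_exp_le_of_deriv_ne_zero {f : ℝ → ℝ} (hf : ContDiff ℝ 2 f) {a b : ℝ}
    (hab : a ≤ b) (h0 : ∀ x ∈ Set.Icc a b, deriv f x ≠ 0) :
    ‖∫ x in a..b, Complex.exp (Complex.I * (f x : ℂ))‖ ≤
      1 / |deriv f a| + 1 / |deriv f b| +
        ∫ x in a..b, |deriv (deriv f) x| / (deriv f x) ^ 2 := by
  have hI : Set.uIcc a b = Set.Icc a b := Set.uIcc_of_le hab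
  have hf1 : ContDiff ℝ 1 (deriv f) := hf.deriv'
  have hc1 : Continuous (deriv f) := hf1.continuous
  have hc2 : Continuous (deriv (deriv f)) := hf1.continuous_deriv le_rfl
  have hd0 : ∀ x, HasDerivAt f (deriv f x) x := fun x =>
    ((hf.differentiable (by norm_num)) x).hasDerivAt
  have hd1 : ∀ x, HasDerivAt (deriv f) (deriv (deriv f) x) x := fun x =>
    ((hf1.differentiable (by norm_num)) x).hasDerivAt
  set v : ℝ → ℂ := fun x => Complex.exp (Complex.I * (f x : ℂ)) with hv
  -- This is `1 / (i f')`, so that `u v' = v`.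
  set u : ℝ → ℂ := fun x => (((deriv f x)⁻¹ : ℝ) : ℂ) * (-Complex.I) with hu
  have hv' : ∀ x, HasDerivAt v (v x * (Complex.I * ((deriv f x : ℝ) : ℂ))) x := by
    intro x
    have e1 := ((hd0 x).ofReal_comp).const_mul Complex.I
    exact e1.cexp
  have hu' : ∀ x ∈ Set.uIcc a b, HasDerivAt u
      (((-(deriv (deriv f) x) / (deriv f x) ^ 2 : ℝ) : ℂ) * (-Complex.I)) x := by
    intro x hx
    have e1 := ((hd1 x).fun_inv (h0 x (hI ▸ hx))).ofReal_comp
    exact e1.mul_const (-Complex.I)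
  have hvc : Continuous v := by
    simp only [hv]; have := hf.continuous; fun_prop
  have hcq : ContinuousOn (fun x => -(deriv (deriv f) x) / (deriv f x) ^ 2) (Set.uIcc a b) :=
    (hc2.neg.continuousOn).div ((hc1.pow 2).continuousOn)
      (fun x hx => pow_ne_zero 2 (h0 x (hI ▸ hx)))
  have hu'i : IntervalIntegrable
      (fun x => ((-(deriv (deriv f) x) / (deriv f x) ^ 2 : ℝ) : ℂ) * (-Complex.I)) volume a b := by
    apply ContinuousOn.intervalIntegrable
    exact (Complex.continuous_ofReal.comp_continuousOn hcq).mul continuousOn_const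
  have hv'i : IntervalIntegrable (fun x => v x * (Complex.I * ((deriv f x : ℝ) : ℂ))) volume a b := by
    apply Continuous.intervalIntegrable
    fun_prop
  have key := intervalIntegral.integral_mul_deriv_eq_deriv_mul hu' (fun x _ => hv' x) hu'i hv'i
  have hL : ∫ x in a..b, u x * (v x * (Complex.I * ((deriv f x : ℝ) : ℂ))) = ∫ x in a..b, v x := by
    apply intervalIntegral.integral_congr
    intro x hx
    have hne : ((deriv f x : ℝ) : ℂ) ≠ 0 := by exact_mod_cast h0 x (hI ▸ hx)
    simp only [hu, Complex.ofReal_inv]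
    field_simp
    rw [Complex.I_sq]; ring
  rw [hL] at key
  have hvn : ∀ x, ‖v x‖ = 1 := fun x => norm_exp_I_mul_ofReal _
  have hun : ∀ x, ‖u x * v x‖ = 1 / |deriv f x| := by
    intro x; rw [norm_mul, hvn]; simp [hu]
  have h3 : ‖∫ x in a..b, (((-(deriv (deriv f) x) / (deriv f x) ^ 2 : ℝ) : ℂ) * (-Complex.I)) * v x‖
      ≤ ∫ x in a..b, |deriv (deriv f) x| / (deriv f x) ^ 2 := by
    refine (intervalIntegral.norm_integral_le_integral_norm hab).trans (le_of_eq ?_)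
    apply intervalIntegral.integral_congr
    intro x hx
    simp only
    rw [norm_mul, hvn, norm_mul, norm_neg, Complex.norm_I, Complex.norm_real, Real.norm_eq_abs,
      abs_div, abs_neg, abs_of_nonneg (sq_nonneg (deriv f x)), mul_one, mul_one]
  rw [key]
  refine (norm_sub_le _ _).trans (add_le_add ((norm_sub_le _ _).trans ?_) h3)
  rw [hun, hun, add_comm]

/-- A bound on `f''` replaces the sign condition. It is useful when `B` is comparable to `lam`,
since both terms are then `O(1 / lam)`. -/
theorem norm_integral_exp_le_of_le_abs_deriv {f : ℝ → ℝ} (hf : ContDiff ℝ 2 f) {a b lam B : ℝ}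
    (hab : a ≤ b) (hlam : 0 < lam) (h1 : ∀ x ∈ Set.Icc a b, lam ≤ |deriv f x|)
    (h2 : ∀ x ∈ Set.Icc a b, |deriv (deriv f) x| ≤ B) :
    ‖∫ x in a..b, Complex.exp (Complex.I * (f x : ℂ))‖ ≤ 2 / lam + (b - a) * B / lam ^ 2 := by
  have h0 : ∀ x ∈ Set.Icc a b, deriv f x ≠ 0 := fun x hx h => by
    have := h1 x hx; rw [h, abs_zero] at this; linarith
  refine (norm_integral_exp_le_of_deriv_ne_zero hf hab h0).trans ?_
  have ha : 1 / |deriv f a| ≤ 1 / lam :=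
    one_div_le_one_div_of_le hlam (h1 a (Set.left_mem_Icc.2 hab))
  have hb : 1 / |deriv f b| ≤ 1 / lam :=
    one_div_le_one_div_of_le hlam (h1 b (Set.right_mem_Icc.2 hab))
  have hi : ∫ x in a..b, |deriv (deriv f) x| / (deriv f x) ^ 2 ≤ (b - a) * B / lam ^ 2 := by
    have := intervalIntegral.norm_integral_le_of_norm_le_const (a := a) (b := b) (C := B / lam ^ 2)
      (f := fun x => |deriv (deriv f) x| / (deriv f x) ^ 2) (fun x hx => by
        rw [Set.uIoc_of_le hab] at hx
        have hx' := Set.Ioc_subset_Icc_self hx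
        rw [Real.norm_eq_abs, abs_div, abs_abs, abs_of_nonneg (sq_nonneg (deriv f x)),
          ← sq_abs (deriv f x)]
        have := h1 x hx'
        have := h2 x hx'
        have := abs_nonneg (deriv (deriv f) x)
        gcongr
        linarith)
    refine (le_abs_self _).trans (this.trans (le_of_eq ?_))
    rw [abs_of_nonneg (sub_nonneg.2 hab)]; ring
  have : (2 : ℝ) / lam = 1 / lam + 1 / lam := by ring
  linarith

/-- When `f''` keeps its sign, `|f''| / f'^2` is, up to sign, the derivative of `1 / f'`, so its
integral is a difference of boundary values. -/
theorem norm_integral_exp_le_of_signed {f : ℝ → ℝ} (hf : ContDiff ℝ 2 f) {a b lam : ℝ}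
    (hab : a ≤ b) (hlam : 0 < lam) (h1 : ∀ x ∈ Set.Icc a b, lam ≤ |deriv f x|)
    (h2 : (∀ x ∈ Set.Icc a b, 0 ≤ deriv (deriv f) x) ∨
      (∀ x ∈ Set.Icc a b, deriv (deriv f) x ≤ 0)) :
    ‖∫ x in a..b, Complex.exp (Complex.I * (f x : ℂ))‖ ≤ 4 / lam := by
  have hI : Set.uIcc a b = Set.Icc a b := Set.uIcc_of_le hab
  have h0 : ∀ x ∈ Set.Icc a b, deriv f x ≠ 0 := fun x hx h => by
    have := h1 x hx; rw [h, abs_zero] at this; linarith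
  refine (norm_integral_exp_le_of_deriv_ne_zero hf hab h0).trans ?_
  have ha : 1 / |deriv f a| ≤ 1 / lam :=
    one_div_le_one_div_of_le hlam (h1 a (Set.left_mem_Icc.2 hab))
  have hb : 1 / |deriv f b| ≤ 1 / lam :=
    one_div_le_one_div_of_le hlam (h1 b (Set.right_mem_Icc.2 hab))
  have hf1 : ContDiff ℝ 1 (deriv f) := hf.deriv'
  have hc1 : Continuous (deriv f) := hf1.continuous
  have hc2 : Continuous (deriv (deriv f)) := hf1.continuous_deriv le_rfl
  have hd1 : ∀ x, HasDerivAt (deriv f) (deriv (deriv f) x) x := fun x =>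
    ((hf1.differentiable (by norm_num)) x).hasDerivAt
  have hcq : ContinuousOn (fun x => -(deriv (deriv f) x) / (deriv f x) ^ 2) (Set.uIcc a b) :=
    (hc2.neg.continuousOn).div ((hc1.pow 2).continuousOn)
      (fun x hx => pow_ne_zero 2 (h0 x (hI ▸ hx)))
  have hint := intervalIntegral.integral_eq_sub_of_hasDerivAt
    (fun x hx => (hd1 x).fun_inv (h0 x (hI ▸ hx))) hcq.intervalIntegrable
  have hbd : |(deriv f b)⁻¹ - (deriv f a)⁻¹| ≤ 2 / lam := by
    refine (abs_sub _ _).trans ?_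
    rw [abs_inv, abs_inv, ← one_div, ← one_div]
    have : (2 : ℝ) / lam = 1 / lam + 1 / lam := by ring
    linarith
  have hi : ∫ x in a..b, |deriv (deriv f) x| / (deriv f x) ^ 2 ≤ 2 / lam := by
    rcases h2 with h2 | h2
    · have : ∫ x in a..b, |deriv (deriv f) x| / (deriv f x) ^ 2
          = -∫ x in a..b, -(deriv (deriv f) x) / (deriv f x) ^ 2 := by
        rw [← intervalIntegral.integral_neg]
        apply intervalIntegral.integral_congr
        intro x hx
        simp only
        rw [abs_of_nonneg (h2 x (hI ▸ hx))]; ring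
      rw [this, hint]
      exact (neg_le_abs _).trans hbd
    · have : ∫ x in a..b, |deriv (deriv f) x| / (deriv f x) ^ 2
          = ∫ x in a..b, -(deriv (deriv f) x) / (deriv f x) ^ 2 := by
        apply intervalIntegral.integral_congr
        intro x hx
        simp only
        rw [abs_of_nonpos (h2 x (hI ▸ hx))]
      rw [this, hint]
      exact (le_abs_self _).trans hbd
  have : (4 : ℝ) / lam = 1 / lam + 1 / lam + 2 / lam := by ring
  linarith

theorem forall_nonneg_or_forall_nonpos_of_ne_zero {φ : ℝ → ℝ} {a b : ℝ} (hφ : Continuous φ)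
    (h0 : ∀ x ∈ Set.Icc a b, φ x ≠ 0) :
    (∀ x ∈ Set.Icc a b, 0 ≤ φ x) ∨ (∀ x ∈ Set.Icc a b, φ x ≤ 0) := by
  by_contra! h
  obtain ⟨⟨x, hx, hx0⟩, y, hy, hy0⟩ := h
  obtain ⟨z, hz, hz0⟩ := isPreconnected_Icc.intermediate_value hx hy hφ.continuousOn
    ⟨hx0.le, hy0.le⟩
  exact h0 z hz hz0

theorem mul_abs_sub_le_of_le_abs_deriv {φ φ' : ℝ → ℝ} {a b lam : ℝ}
    (hφ : ∀ x ∈ Set.Icc a b, HasDerivAt φ (φ' x) x)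
    (h : ∀ x ∈ Set.Icc a b, lam ≤ |φ' x|) {x y : ℝ} (hx : x ∈ Set.Icc a b)
    (hy : y ∈ Set.Icc a b) : lam * |x - y| ≤ |φ x - φ y| := by
  wlog hxy : x < y generalizing x y
  · rcases (not_lt.1 hxy).eq_or_lt with rfl | hlt
    · simp
    · rw [abs_sub_comm x, abs_sub_comm (φ x)]; exact this hy hx hlt
  have hsub : Set.Icc x y ⊆ Set.Icc a b := Set.Icc_subset_Icc hx.1 hy.2
  obtain ⟨c, hc, hc'⟩ := exists_hasDerivAt_eq_slope φ φ' hxy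
    (fun t ht => (hφ t (hsub ht)).continuousAt.continuousWithinAt)
    (fun t ht => hφ t (hsub (Set.Ioo_subset_Icc_self ht)))
  have hne : y - x ≠ 0 := by linarith
  rw [eq_div_iff hne] at hc'
  rw [abs_sub_comm (φ x), ← hc', abs_mul, abs_sub_comm x]
  exact mul_le_mul_of_nonneg_right (h c (hsub (Set.Ioo_subset_Icc_self hc))) (abs_nonneg _)

/-- The conclusion of van der Corput's lemma for the derivative of order `r + 1`, under the sign
condition on the next derivative that is needed when `r = 0`. -/
def VanDerCorputBound (r : ℕ) (C : ℝ) : Prop :=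
  ∀ (f : ℝ → ℝ) (a b lam : ℝ), ContDiff ℝ (⊤ : ℕ∞) f → a ≤ b → 0 < lam →
    (∀ x ∈ Set.Icc a b, lam ≤ |iteratedDeriv (r + 1) f x|) →
    ((∀ x ∈ Set.Icc a b, 0 ≤ iteratedDeriv (r + 2) f x) ∨
      (∀ x ∈ Set.Icc a b, iteratedDeriv (r + 2) f x ≤ 0)) →
    ‖∫ x in a..b, Complex.exp (Complex.I * (f x : ℂ))‖ ≤ C * lam ^ (-(1 : ℝ) / (r + 1 : ℕ))

/-- Induction step: the derivative `φ` of order `r + 1` can be small only near one point. The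
interval is cut there, with the trivial bound on a neighbourhood of radius `η` and the previous
order outside it. -/
theorem VanDerCorputBound.succ {r : ℕ} {C : ℝ} (hC0 : 0 ≤ C) (hC : VanDerCorputBound r C)
    {f : ℝ → ℝ} {a b lam : ℝ} (hf : ContDiff ℝ (⊤ : ℕ∞) f) (hab : a ≤ b) (hlam : 0 < lam)
    (h1 : ∀ x ∈ Set.Icc a b, lam ≤ |iteratedDeriv (r + 2) f x|) :
    ‖∫ x in a..b, Complex.exp (Complex.I * (f x : ℂ))‖ ≤
      (4 * C + 2) * lam ^ (-(1 : ℝ) / (r + 2 : ℕ)) := by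
  set φ := iteratedDeriv (r + 1) f with hφdef
  have hφd : ∀ x, HasDerivAt φ (iteratedDeriv (r + 2) f x) x := fun x => by
    rw [iteratedDeriv_succ]
    exact ((hf.differentiable_iteratedDeriv (r + 1) (by exact_mod_cast ENat.natCast_lt_top _)) x).hasDerivAt
  have hφc : Continuous φ := continuous_iff_continuousAt.2 fun x => (hφd x).continuousAt
  have hφ'c : Continuous (iteratedDeriv (r + 2) f) :=
    (contDiff_infty.1 hf (r + 2)).continuous_iteratedDeriv' (r + 2)
  -- The derivative of order `r + 2` has no zero, so the sign condition required by the previous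
  -- order holds automatically.
  have hsign := forall_nonneg_or_forall_nonpos_of_ne_zero (a := a) (b := b) hφ'c (fun x hx h => by
    have := h1 x hx; rw [h, abs_zero] at this; linarith)
  -- A minimiser of `|φ|` serves whether or not `φ` vanishes; comparing with it costs only a factor
  -- `2`.
  obtain ⟨x0, hx0, hmin⟩ := isCompact_Icc.exists_isMinOn (Set.nonempty_Icc.2 hab)
    (hφc.abs.continuousOn (s := Set.Icc a b))
  have hlow : ∀ x ∈ Set.Icc a b, lam * |x - x0| / 2 ≤ |φ x| := fun x hx => by
    have e1 := mul_abs_sub_le_of_le_abs_deriv (fun x _ => hφd x) h1 hx hx0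
    have e2 : |φ x0| ≤ |φ x| := hmin hx
    have e3 := abs_sub (φ x) (φ x0)
    linarith
  set q : ℝ := (-(1 : ℝ) / ((r + 2 : ℕ) : ℝ)) with hq
  -- This radius balances the two contributions: `(lam * η) ^ (-1 / (r + 1)) = η`.
  set η : ℝ := lam ^ q with hη
  have hηpos : 0 < η := Real.rpow_pos_of_pos hlam _
  have hbound : C * (lam * η / 2) ^ (-(1 : ℝ) / (r + 1 : ℕ)) ≤ 2 * C * η := by
    have e1 : lam * η = lam ^ (1 + q) := by
      rw [Real.rpow_add hlam, Real.rpow_one]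
    have e2 : (lam * η / 2) ^ (-(1 : ℝ) / (r + 1 : ℕ)) =
        η * (2 : ℝ) ^ ((1 : ℝ) / (r + 1 : ℕ)) := by
      rw [Real.div_rpow (by positivity) (by norm_num), e1, ← Real.rpow_mul hlam.le,
        div_eq_mul_inv, ← Real.rpow_neg (by norm_num : (0 : ℝ) ≤ 2)]
      congr 2
      · rw [hq]; push_cast; field_simp; ring
      · ring
    have e3 : (2 : ℝ) ^ ((1 : ℝ) / (r + 1 : ℕ)) ≤ 2 := by
      have : (2 : ℝ) ^ ((1 : ℝ) / (r + 1 : ℕ)) ≤ 2 ^ (1 : ℝ) := by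
        apply Real.rpow_le_rpow_of_exponent_le (by norm_num)
        rw [div_le_one (by positivity)]; push_cast; linarith [(Nat.cast_nonneg r : (0 : ℝ) ≤ r)]
      simpa using this
    rw [e2]
    nlinarith [mul_nonneg hC0 hηpos.le]
  have hpiece : ∀ s t : ℝ, a ≤ s → s ≤ t → t ≤ b → (∀ x ∈ Set.Icc s t, η ≤ |x - x0|) →
      ‖∫ x in s..t, Complex.exp (Complex.I * (f x : ℂ))‖ ≤ 2 * C * η := fun s t has hst htb hx => by
    have hsub : Set.Icc s t ⊆ Set.Icc a b := Set.Icc_subset_Icc has htb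
    refine (hC f s t (lam * η / 2) hf hst (by positivity) (fun x hx' => ?_) ?_).trans hbound
    · refine le_trans ?_ (hlow x (hsub hx'))
      have := hx x hx'
      gcongr
    · exact hsign.imp (fun h x hx => h x (hsub hx)) (fun h x hx => h x (hsub hx))
  have hfc : Continuous fun x => Complex.exp (Complex.I * (f x : ℂ)) := by
    have := hf.continuous; fun_prop
  have hII : ∀ s t : ℝ, IntervalIntegrable
      (fun x => Complex.exp (Complex.I * (f x : ℂ))) volume s t := fun s t =>
    hfc.intervalIntegrable s t
  set c := max a (x0 - η) with hc
  set d := min b (x0 + η) with hd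
  have hac : a ≤ c := le_max_left _ _
  have hcx : c ≤ x0 := max_le hx0.1 (by linarith)
  have hxd : x0 ≤ d := le_min hx0.2 (by linarith)
  have hdb : d ≤ b := min_le_left _ _
  have p1 : ‖∫ x in a..c, Complex.exp (Complex.I * (f x : ℂ))‖ ≤ 2 * C * η := by
    rcases le_total (x0 - η) a with h | h
    · rw [hc, max_eq_left h, intervalIntegral.integral_same, norm_zero]; positivity
    · apply hpiece a c le_rfl hac (hcx.trans hx0.2)
      intro x hx
      have : x ≤ x0 - η := by rw [hc, max_eq_right h] at hx; exact hx.2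
      rw [abs_sub_comm]; exact le_trans (by linarith) (le_abs_self _)
  have p3 : ‖∫ x in d..b, Complex.exp (Complex.I * (f x : ℂ))‖ ≤ 2 * C * η := by
    rcases le_total b (x0 + η) with h | h
    · rw [hd, min_eq_left h, intervalIntegral.integral_same, norm_zero]; positivity
    · apply hpiece d b (hx0.1.trans hxd) hdb le_rfl
      intro x hx
      have : x0 + η ≤ x := by rw [hd, min_eq_right h] at hx; exact hx.1
      exact le_trans (by linarith) (le_abs_self _)
  have p2 : ‖∫ x in c..d, Complex.exp (Complex.I * (f x : ℂ))‖ ≤ 2 * η := by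
    refine (norm_integral_exp_le_length f (hcx.trans hxd)).trans ?_
    have : x0 - η ≤ c := le_max_right _ _
    have : d ≤ x0 + η := min_le_right _ _
    linarith
  rw [← intervalIntegral.integral_add_adjacent_intervals (hII a c) (hII c b),
    ← intervalIntegral.integral_add_adjacent_intervals (hII c d) (hII d b)]
  refine (norm_add_le _ _).trans ?_
  have := norm_add_le (∫ x in c..d, Complex.exp (Complex.I * (f x : ℂ)))
    (∫ x in d..b, Complex.exp (Complex.I * (f x : ℂ)))
  nlinarith

theorem exists_vanDerCorputBound (r : ℕ) : ∃ C : ℝ, 0 ≤ C ∧ VanDerCorputBound r C := by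
  induction r with
  | zero =>
    refine ⟨4, by norm_num, fun f a b lam hf hab hlam h1 h2 => ?_⟩
    have := norm_integral_exp_le_of_signed (contDiff_infty.1 hf 2) hab hlam
      (by simpa [iteratedDeriv_one] using h1)
      (by simpa [iteratedDeriv_succ, iteratedDeriv_zero] using h2)
    refine this.trans (le_of_eq ?_)
    norm_num [Real.rpow_neg_one, div_eq_mul_inv]
  | succ r ih =>
    obtain ⟨C, hC0, hC⟩ := ih
    exact ⟨4 * C + 2, by positivity, fun f a b lam hf hab hlam h1 _ => hC.succ hC0 hf hab hlam h1⟩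

/-- **Van der Corput's lemma** for derivatives of order at least two. -/
theorem van_der_corput {r : ℕ} (hr : 2 ≤ r) : ∃ C : ℝ, 0 ≤ C ∧ ∀ (f : ℝ → ℝ) (a b lam : ℝ),
    ContDiff ℝ (⊤ : ℕ∞) f → a ≤ b → 0 < lam →
    (∀ x ∈ Set.Icc a b, lam ≤ |iteratedDeriv r f x|) →
    ‖∫ x in a..b, Complex.exp (Complex.I * (f x : ℂ))‖ ≤ C * lam ^ (-(1 : ℝ) / r) := by
  obtain ⟨r, rfl⟩ := Nat.exists_eq_add_of_le' hr
  obtain ⟨C, hC0, hC⟩ := exists_vanDerCorputBound r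
  exact ⟨4 * C + 2, by positivity, fun f a b lam hf hab hlam h1 => hC.succ hC0 hf hab hlam h1⟩

/-! ### Almost everywhere convergence of averages along lacunary subsequences. -/

/-- Adding `N` to the partial sums makes them monotone, because each term is at least `-1`.
Convergence along the sequences `⌊c^j⌋` with `c` close to `1` then controls all `N`. -/
theorem tendsto_sum_div_of_tendsto_floor_pow_real {x : ℕ → ℝ} (hx : ∀ n, |x n| ≤ 1)
    {c : ℕ → ℝ} (hc1 : ∀ k, 1 < c k) (hc : Tendsto c atTop (𝓝 1))
    (h : ∀ k, Tendsto (fun j : ℕ =>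
      (∑ n ∈ Finset.Icc 1 ⌊c k ^ j⌋₊, x n) / (⌊c k ^ j⌋₊ : ℝ)) atTop (𝓝 0)) :
    Tendsto (fun N : ℕ => (∑ n ∈ Finset.Icc 1 N, x n) / (N : ℝ)) atTop (𝓝 0) := by
  have hne : ∀ᶠ N : ℕ in atTop, (N : ℝ) ≠ 0 :=
    (eventually_gt_atTop 0).mono fun N hN => by positivity
  have key := tendsto_div_of_monotone_of_tendsto_div_floor_pow
    (fun N : ℕ => (∑ n ∈ Finset.Icc 1 N, x n) + (N : ℝ)) 1
    (monotone_nat_of_le_succ fun N => by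
      rw [Finset.sum_Icc_succ_top (by omega)]
      have := (abs_le.1 (hx (N + 1))).1
      push_cast
      linarith) c hc1 hc (fun k => by
      have hfl : Tendsto (fun j : ℕ => ⌊c k ^ j⌋₊) atTop atTop :=
        tendsto_nat_floor_atTop.comp (tendsto_pow_atTop_atTop_of_one_lt (hc1 k))
      have := (h k).add_const 1
      rw [zero_add] at this
      refine this.congr' ?_
      filter_upwards [hfl.eventually hne] with j hj
      field_simp)
  have := key.sub_const 1
  rw [sub_self] at this
  refine this.congr' ?_
  filter_upwards [hne] with N hN
  field_simp
  ring

theorem tendsto_sum_div_of_tendsto_floor_pow {z : ℕ → ℂ} (hz : ∀ n, ‖z n‖ ≤ 1)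
    {c : ℕ → ℝ} (hc1 : ∀ k, 1 < c k) (hc : Tendsto c atTop (𝓝 1))
    (h : ∀ k, Tendsto (fun j : ℕ =>
      ‖∑ n ∈ Finset.Icc 1 ⌊c k ^ j⌋₊, z n‖ / (⌊c k ^ j⌋₊ : ℝ)) atTop (𝓝 0)) :
    Tendsto (fun N : ℕ => (∑ n ∈ Finset.Icc 1 N, z n) / (N : ℂ)) atTop (𝓝 0) := by
  have hre := tendsto_sum_div_of_tendsto_floor_pow_real (x := fun n => (z n).re)
    (fun n => (Complex.abs_re_le_norm _).trans (hz n)) hc1 hc (fun k =>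
      squeeze_zero_norm (fun j => by
        rw [norm_div, Real.norm_eq_abs, ← Complex.re_sum, RCLike.norm_natCast]
        gcongr
        exact Complex.abs_re_le_norm _) (h k))
  have him := tendsto_sum_div_of_tendsto_floor_pow_real (x := fun n => (z n).im)
    (fun n => (Complex.abs_im_le_norm _).trans (hz n)) hc1 hc (fun k =>
      squeeze_zero_norm (fun j => by
        rw [norm_div, Real.norm_eq_abs, ← Complex.im_sum, RCLike.norm_natCast]
        gcongr
        exact Complex.abs_im_le_norm _) (h k))
  have h2 := ((Complex.continuous_ofReal.tendsto _).comp hre).add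
    (((Complex.continuous_ofReal.tendsto _).comp him).mul_const Complex.I)
  simp only [Complex.ofReal_zero, zero_mul, add_zero] at h2
  refine h2.congr fun N => ?_
  simp only [Function.comp, Complex.ofReal_div, Complex.ofReal_natCast]
  rw [← Complex.re_sum, ← Complex.im_sum, div_mul_eq_mul_div, ← add_div, Complex.re_add_im]

theorem half_mul_log_le_log_floor_pow {c : ℝ} (hc : 1 < c) :
    ∀ᶠ j : ℕ in atTop, (j : ℝ) * (Real.log c / 2) ≤ Real.log (⌊c ^ j⌋₊ : ℝ) := by
  have hlc : 0 < Real.log c := Real.log_pos hc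
  have ht : Tendsto (fun j : ℕ => (j : ℝ) * (Real.log c / 2)) atTop atTop :=
    tendsto_natCast_atTop_atTop.atTop_mul_const (by positivity)
  filter_upwards [ht.eventually_ge_atTop (Real.log 2)] with j hj
  have h1 : (1 : ℝ) ≤ c ^ j := one_le_pow₀ hc.le
  have h2 : c ^ j / 2 ≤ (⌊c ^ j⌋₊ : ℝ) := by
    have a1 : (1 : ℝ) ≤ (⌊c ^ j⌋₊ : ℝ) := by exact_mod_cast (Nat.one_le_floor_iff _).2 h1
    have a2 := Nat.lt_floor_add_one (c ^ j)
    linarith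
  have h3 := Real.log_le_log (by positivity) h2
  rw [Real.log_div (by positivity) (by norm_num), Real.log_pow] at h3
  linarith

/-- Since `log ⌊c^j⌋` grows at least linearly in `j`, this is dominated by a convergent `p`-series.
Here the `ε` in the definition of scattered is needed. -/
theorem summable_one_div_log_floor_pow {c ε : ℝ} (hc : 1 < c) (hε : 0 < ε) :
    Summable fun j : ℕ => 1 / Real.log (⌊c ^ j⌋₊ : ℝ) ^ (1 + ε) := by
  have hlc : 0 < Real.log c := Real.log_pos hc
  have hs : Summable fun j : ℕ => (Real.log c / 2) ^ (-(1 + ε)) * (1 / (j : ℝ) ^ (1 + ε)) :=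
    (Real.summable_one_div_nat_rpow.2 (by linarith)).mul_left _
  refine Summable.of_norm_bounded_eventually_nat hs ?_
  filter_upwards [half_mul_log_le_log_floor_pow hc, eventually_gt_atTop 0] with j hj hj0
  have hj0' : (0 : ℝ) < j := by exact_mod_cast hj0
  have hpos : 0 < (j : ℝ) * (Real.log c / 2) := by positivity
  have hl : 0 < Real.log (⌊c ^ j⌋₊ : ℝ) := hpos.trans_le hj
  rw [Real.norm_of_nonneg (by positivity)]
  have : 1 / Real.log (⌊c ^ j⌋₊ : ℝ) ^ (1 + ε) ≤ 1 / ((j : ℝ) * (Real.log c / 2)) ^ (1 + ε) :=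
    one_div_le_one_div_of_le (by positivity) (Real.rpow_le_rpow hpos.le hj (by linarith))
  refine this.trans (le_of_eq ?_)
  rw [Real.mul_rpow hj0'.le (by positivity), Real.rpow_neg (by positivity)]
  field_simp

theorem ae_tendsto_zero_of_summable_integral {α : Type*} [MeasurableSpace α] {μ : Measure α}
    {f : ℕ → α → ℝ} (hf : ∀ j, Integrable (f j) μ) (h0 : ∀ j x, 0 ≤ f j x)
    (hs : Summable fun j => ∫ x, f j x ∂μ) :
    ∀ᵐ x ∂μ, Tendsto (fun j => f j x) atTop (𝓝 0) := by
  have hm : ∀ j, AEMeasurable (fun x => ENNReal.ofReal (f j x)) μ := fun j =>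
    (hf j).aemeasurable.ennreal_ofReal
  have h1 : ∫⁻ x, ∑' j, ENNReal.ofReal (f j x) ∂μ ≠ ⊤ := by
    rw [lintegral_tsum hm]
    have : ∀ j, ∫⁻ x, ENNReal.ofReal (f j x) ∂μ = ENNReal.ofReal (∫ x, f j x ∂μ) := fun j =>
      (ofReal_integral_eq_lintegral_ofReal (hf j) (ae_of_all _ (h0 j))).symm
    simp_rw [this]
    exact hs.tsum_ofReal_ne_top
  filter_upwards [ae_lt_top' (AEMeasurable.tsum hm) h1] with x hx
  have h2 := ENNReal.tendsto_atTop_zero_of_tsum_ne_top hx.ne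
  have h3 := (ENNReal.tendsto_toReal ENNReal.zero_ne_top).comp h2
  refine h3.congr fun j => ?_
  simp [ENNReal.toReal_ofReal (h0 j x)]

/-- The Davenport–Erdős–LeVeque criterion for almost everywhere convergence of averages. -/
theorem ae_tendsto_average_of_integral_sq_le {α : Type*} [MeasurableSpace α] {μ : Measure α}
    [IsFiniteMeasure μ] {e : ℕ → α → ℂ} (he : ∀ n, AEStronglyMeasurable (e n) μ)
    (h1 : ∀ n x, ‖e n x‖ ≤ 1) {C ε : ℝ} (hε : 0 < ε)
    (h : ∀ᶠ N : ℕ in atTop, (∫ x, ‖∑ n ∈ Finset.Icc 1 N, e n x‖ ^ 2 ∂μ) / (N : ℝ) ^ 2 ≤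
      C * (1 / Real.log N ^ (1 + ε))) :
    ∀ᵐ x ∂μ, Tendsto (fun N : ℕ => (∑ n ∈ Finset.Icc 1 N, e n x) / (N : ℂ)) atTop (𝓝 0) := by
  have hbd : ∀ (N : ℕ) x, ‖∑ n ∈ Finset.Icc 1 N, e n x‖ ≤ N := fun N x => by
    refine (norm_sum_le_of_le _ fun n _ => h1 n x).trans ?_
    simp
  have hint : ∀ N : ℕ, Integrable (fun x => ‖∑ n ∈ Finset.Icc 1 N, e n x‖ ^ 2) μ := fun N => by
    refine Integrable.of_bound (C := (N : ℝ) ^ 2)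
      ((Finset.aestronglyMeasurable_fun_sum _ fun n _ => he n).norm.pow 2) (ae_of_all _ fun x => ?_)
    rw [Real.norm_of_nonneg (by positivity)]
    exact pow_le_pow_left₀ (norm_nonneg _) (hbd N x) 2
  -- Countably many ratios suffice, so the exceptional null sets can be united.
  set c : ℕ → ℝ := fun k => 1 + 1 / ((k : ℝ) + 1) with hcdef
  have hc1 : ∀ k, 1 < c k := fun k => by
    have : (0 : ℝ) < 1 / ((k : ℝ) + 1) := by positivity
    simp only [hcdef]; linarith
  have hc : Tendsto c atTop (𝓝 1) := by
    have := (tendsto_one_div_add_atTop_nhds_zero_nat (𝕜 := ℝ)).const_add 1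
    rwa [add_zero] at this
  have hae : ∀ k, ∀ᵐ x ∂μ, Tendsto (fun j : ℕ =>
      ‖∑ n ∈ Finset.Icc 1 ⌊c k ^ j⌋₊, e n x‖ ^ 2 / (⌊c k ^ j⌋₊ : ℝ) ^ 2) atTop (𝓝 0) := fun k => by
    refine ae_tendsto_zero_of_summable_integral (fun j => (hint _).div_const _)
      (fun j x => by positivity) ?_
    have hfl : Tendsto (fun j : ℕ => ⌊c k ^ j⌋₊) atTop atTop :=
      tendsto_nat_floor_atTop.comp (tendsto_pow_atTop_atTop_of_one_lt (hc1 k))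
    refine Summable.of_norm_bounded_eventually_nat
      ((summable_one_div_log_floor_pow (hc1 k) hε).mul_left C) ?_
    filter_upwards [hfl.eventually h] with j hj
    rw [integral_div, Real.norm_of_nonneg (by positivity)]
    exact hj
  filter_upwards [ae_all_iff.2 hae] with x hx
  refine tendsto_sum_div_of_tendsto_floor_pow (fun n => h1 n x) hc1 hc fun k => ?_
  have := (hx k).sqrt
  rw [Real.sqrt_zero] at this
  refine this.congr fun j => ?_
  rw [← div_pow, Real.sqrt_sq (by positivity)]

theorem truncKernel_nonneg (δ : ℝ) {t : ℝ} (ht : 0 ≤ t) : 0 ≤ truncKernel δ t := by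
  unfold truncKernel
  split_ifs
  · exact zero_le_one
  · exact le_min (Real.rpow_nonneg ht _) zero_le_one

theorem integral_norm_sum_sq_le {α : Type*} [MeasurableSpace α] {μ : Measure α}
    [IsFiniteMeasure μ] {e : ℕ → α → ℂ} (he : ∀ n, AEStronglyMeasurable (e n) μ)
    (h1 : ∀ n x, ‖e n x‖ ≤ 1) (N : ℕ) :
    ∫ x, ‖∑ n ∈ Finset.Icc 1 N, e n x‖ ^ 2 ∂μ ≤
      ∑ n ∈ Finset.Icc 1 N, (μ.real Set.univ +
        2 * ∑ m ∈ Finset.Ico 1 n, ‖∫ x, e n x * (starRingEnd ℂ) (e m x) ∂μ‖) := by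
  have hprod : ∀ n m, Integrable (fun x => e n x * (starRingEnd ℂ) (e m x)) μ := fun n m => by
    refine Integrable.of_bound (C := 1) ((he n).mul (Complex.continuous_conj.comp_aestronglyMeasurable (he m)))
      (ae_of_all _ fun x => ?_)
    rw [norm_mul, RCLike.norm_conj]
    exact mul_le_one₀ (h1 n x) (norm_nonneg _) (h1 m x)
  have hsq : ∀ f : α → ℂ, ∀ B : ℝ, AEStronglyMeasurable f μ → (∀ x, ‖f x‖ ≤ B) →
      Integrable (fun x => ‖f x‖ ^ 2) μ := fun f B hf hB => by
    refine Integrable.of_bound (C := B ^ 2) (hf.norm.pow 2) (ae_of_all _ fun x => ?_)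
    rw [Real.norm_of_nonneg (by positivity)]
    exact pow_le_pow_left₀ (norm_nonneg _) (hB x) 2
  induction N with
  | zero => simp
  | succ N ih =>
    rw [Finset.sum_Icc_succ_top (by omega)]
    have hexp : ∀ x, ‖∑ n ∈ Finset.Icc 1 (N + 1), e n x‖ ^ 2 =
        ‖∑ n ∈ Finset.Icc 1 N, e n x‖ ^ 2 + (‖e (N + 1) x‖ ^ 2 +
          2 * (∑ m ∈ Finset.Ico 1 (N + 1), e (N + 1) x * (starRingEnd ℂ) (e m x)).re) := fun x => by
      rw [Finset.sum_Icc_succ_top (by omega), add_comm, ← Finset.mul_sum, ← map_sum,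
        show Finset.Ico 1 (N + 1) = Finset.Icc 1 N from rfl, Complex.sq_norm, Complex.sq_norm,
        Complex.sq_norm, Complex.normSq_add]
      ring
    have i1 : Integrable (fun x => ‖∑ n ∈ Finset.Icc 1 N, e n x‖ ^ 2) μ :=
      hsq _ N (Finset.aestronglyMeasurable_fun_sum _ fun n _ => he n) fun x =>
        (norm_sum_le_of_le _ fun n _ => h1 n x).trans (by simp)
    have i2 : Integrable (fun x => ‖e (N + 1) x‖ ^ 2) μ := hsq _ 1 (he _) (h1 _)
    have i3 : Integrable (fun x => ∑ m ∈ Finset.Ico 1 (N + 1),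
        e (N + 1) x * (starRingEnd ℂ) (e m x)) μ := integrable_finsetSum _ fun m _ => hprod _ m
    have i3' : Integrable (fun x => 2 * (∑ m ∈ Finset.Ico 1 (N + 1),
        e (N + 1) x * (starRingEnd ℂ) (e m x)).re) μ := i3.re.const_mul 2
    simp_rw [hexp]
    rw [integral_add i1 (by exact i2.add i3'), integral_add i2 i3', integral_const_mul]
    refine add_le_add ih (add_le_add ?_ (mul_le_mul_of_nonneg_left ?_ (by norm_num)))
    · calc ∫ x, ‖e (N + 1) x‖ ^ 2 ∂μ ≤ ∫ _, (1 : ℝ) ∂μ :=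
            integral_mono i2 (integrable_const 1) fun x =>
              pow_le_one₀ (norm_nonneg _) (h1 _ x)
        _ = μ.real Set.univ := by simp
    · have : ∫ x, (∑ m ∈ Finset.Ico 1 (N + 1), e (N + 1) x * (starRingEnd ℂ) (e m x)).re ∂μ =
          (∫ x, ∑ m ∈ Finset.Ico 1 (N + 1), e (N + 1) x * (starRingEnd ℂ) (e m x) ∂μ).re :=
        integral_re i3
      rw [this, integral_finsetSum _ fun m _ => hprod _ m]
      exact (Complex.re_le_norm _).trans (norm_sum_le _ _)

/-- The sequence `s` is a separate parameter: it need only control the correlations of the `e n`.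
Correlations with `m < n₀` are bounded trivially, at a cost of at most `n₀ * M` for each `n`. -/
theorem ae_tendsto_average_of_scattered {α : Type*} [MeasurableSpace α] {μ : Measure α}
    [IsFiniteMeasure μ] {e : ℕ → α → ℂ} (he : ∀ n, AEStronglyMeasurable (e n) μ)
    (h1 : ∀ n x, ‖e n x‖ ≤ 1) {s : ℕ → ℝ} {δ C : ℝ} (hs : DeltaScattered δ s) (hC : 0 ≤ C)
    (n₀ : ℕ) (h : ∀ n m, n₀ ≤ m → m < n →
      ‖∫ x, e n x * (starRingEnd ℂ) (e m x) ∂μ‖ ≤ C * truncKernel δ |s n - s m|) :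
    ∀ᵐ x ∂μ, Tendsto (fun N : ℕ => (∑ n ∈ Finset.Icc 1 N, e n x) / (N : ℂ)) atTop (𝓝 0) := by
  obtain ⟨ε, hε, hs⟩ := hs
  set M := μ.real Set.univ with hM
  have hM0 : 0 ≤ M := measureReal_nonneg
  have hpair : ∀ n m, m < n → ‖∫ x, e n x * (starRingEnd ℂ) (e m x) ∂μ‖ ≤
      C * truncKernel δ |s n - s m| + if m < n₀ then M else 0 := fun n m hmn => by
    have hK := mul_nonneg hC (truncKernel_nonneg δ (abs_nonneg (s n - s m)))
    split_ifs with hm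
    · have : ‖∫ x, e n x * (starRingEnd ℂ) (e m x) ∂μ‖ ≤ 1 * M :=
        norm_integral_le_of_norm_le_const (ae_of_all _ fun x => by
          rw [norm_mul, RCLike.norm_conj]
          exact mul_le_one₀ (h1 n x) (norm_nonneg _) (h1 m x))
      linarith
    · rw [add_zero]; exact h n m (not_lt.1 hm) hmn
  have hrow : ∀ n, ∑ m ∈ Finset.Ico 1 n, ‖∫ x, e n x * (starRingEnd ℂ) (e m x) ∂μ‖ ≤
      C * ∑ m ∈ Finset.Ico 1 n, truncKernel δ |s n - s m| + n₀ * M := fun n => by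
    refine (Finset.sum_le_sum fun m hm => hpair n m (Finset.mem_Ico.1 hm).2).trans ?_
    rw [Finset.sum_add_distrib, ← Finset.mul_sum, ← Finset.sum_filter, Finset.sum_const,
      nsmul_eq_mul]
    gcongr
    refine (Finset.card_le_card (t := Finset.range n₀) fun m hm => ?_).trans
      (Finset.card_range n₀).le
    simp at hm ⊢; exact hm.2.2
  refine ae_tendsto_average_of_integral_sq_le he h1 (C := M * (1 + 2 * n₀) + 2 * C) hε ?_
  -- The diagonal and the early indices contribute `O(1 / N)` after normalisation, which this
  -- absorbs into the logarithmic bound.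
  have hlog : ∀ᶠ N : ℕ in atTop, Real.log N ^ (1 + ε) ≤ N := by
    have := (isLittleO_log_rpow_rpow_atTop (1 + ε) (one_pos : (0 : ℝ) < 1)).bound one_pos
    filter_upwards [tendsto_natCast_atTop_atTop.eventually this, eventually_ge_atTop 1] with N hN h1N
    have hl : 0 ≤ Real.log N := Real.log_nonneg (by exact_mod_cast h1N)
    rw [Real.norm_of_nonneg (by positivity), Real.norm_of_nonneg (by positivity)] at hN
    simpa using hN
  filter_upwards [hs, hlog, eventually_gt_atTop 1] with N hN hlN hN1
  have hN0 : (0 : ℝ) < N := by positivity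
  have hl : 0 < Real.log N := Real.log_pos (by exact_mod_cast hN1)
  have hlp : 0 < Real.log N ^ (1 + ε) := by positivity
  have hbig : ∫ x, ‖∑ n ∈ Finset.Icc 1 N, e n x‖ ^ 2 ∂μ ≤ N * (M * (1 + 2 * n₀)) +
      2 * C * ∑ n ∈ Finset.Icc 1 N, ∑ m ∈ Finset.Ico 1 n, truncKernel δ |s n - s m| := by
    refine (integral_norm_sum_sq_le he h1 N).trans ?_
    calc _ ≤ ∑ n ∈ Finset.Icc 1 N, (M * (1 + 2 * n₀) +
          2 * C * ∑ m ∈ Finset.Ico 1 n, truncKernel δ |s n - s m|) :=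
          Finset.sum_le_sum fun n _ => by linarith [hrow n]
      _ = _ := by
          rw [Finset.sum_add_distrib, Finset.mul_sum, Finset.sum_const, Nat.card_Icc,
            nsmul_eq_mul, Nat.add_sub_cancel]
  calc _ ≤ (N * (M * (1 + 2 * n₀)) + 2 * C *
        ∑ n ∈ Finset.Icc 1 N, ∑ m ∈ Finset.Ico 1 n, truncKernel δ |s n - s m|) / (N : ℝ) ^ 2 :=
        div_le_div_of_nonneg_right hbig (by positivity)
    _ = M * (1 + 2 * n₀) * (1 / N) + 2 * C * (1 / (N : ℝ) ^ 2 *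
        ∑ n ∈ Finset.Icc 1 N, ∑ m ∈ Finset.Ico 1 n, truncKernel δ |s n - s m|) := by
        field_simp
    _ ≤ M * (1 + 2 * n₀) * (1 / Real.log N ^ (1 + ε)) + 2 * C * (1 / Real.log N ^ (1 + ε)) := by
        gcongr
    _ = _ := by ring

/-! ### Weyl's criterion on the torus. -/

/-- The representative in `[0, 1)` of a point of the circle. -/
noncomputable def circleFract (t : UnitAddCircle) : ℝ := AddCircle.equivIco 1 0 t

theorem circleFract_coe (x : ℝ) : circleFract (x : UnitAddCircle) = Int.fract x := by
  simp [circleFract, AddCircle.coe_equivIco_mk_apply]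

theorem measurable_circleFract : Measurable circleFract :=
  measurable_subtype_coe.comp (AddCircle.measurableEquivIco 1 0).measurable

theorem continuousAt_circleFract {t : UnitAddCircle} (ht : t ≠ 0) :
    ContinuousAt circleFract t :=
  continuousAt_subtype_val.comp (AddCircle.continuousAt_equivIco 1 0 (by simpa using ht))

theorem volume_eq_of_measurableSet_unitAddCircle {B : Set UnitAddCircle} (hB : MeasurableSet B) :
    volume B = volume ((fun x : ℝ => (x : UnitAddCircle)) ⁻¹' B ∩ Set.Ioc 0 1) := by
  have hmp := AddCircle.measurePreserving_mk 1 0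
  rw [← hmp.measure_preimage hB.nullMeasurableSet,
    Measure.restrict_apply (hmp.measurable hB), zero_add]

/-- The two sets can differ only at the endpoints: `0` and `1` are the same point of the circle,
with representative `0`. -/
theorem volume_preimage_circleFract {I : Set ℝ} (hI : MeasurableSet I) (hI1 : I ⊆ Set.Icc 0 1) :
    volume (circleFract ⁻¹' I) = volume I := by
  rw [volume_eq_of_measurableSet_unitAddCircle (measurable_circleFract hI)]
  apply measure_congr
  have h0 : ∀ᵐ x : ℝ, x ≠ 0 := by simp [ae_iff, measure_singleton]
  have h1 : ∀ᵐ x : ℝ, x ≠ 1 := by simp [ae_iff, measure_singleton]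
  filter_upwards [h0, h1] with x hx0 hx1
  apply propext
  change ((circleFract (x : UnitAddCircle) ∈ I) ∧ x ∈ Set.Ioc (0 : ℝ) 1) ↔ x ∈ I
  rw [circleFract_coe]
  constructor
  · rintro ⟨h, hx⟩
    rwa [Int.fract_eq_self.2 ⟨hx.1.le, lt_of_le_of_ne hx.2 hx1⟩] at h
  · intro h
    have hx := hI1 h
    refine ⟨?_, lt_of_le_of_ne hx.1 (Ne.symm hx0), hx.2⟩
    rwa [Int.fract_eq_self.2 ⟨hx.1, lt_of_le_of_ne hx.2 hx1⟩]

/-- `circleFract` jumps only at the point `0`, which is null. Elsewhere a frontier point is mapped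
to the frontier of `I`, null by convexity. -/
theorem volume_frontier_preimage_circleFract {I : Set ℝ} (hI : I.OrdConnected)
    (hI1 : I ⊆ Set.Icc 0 1) : volume (frontier (circleFract ⁻¹' I)) = 0 := by
  have hfr : volume (frontier I) = 0 := hI.convex.addHaar_frontier volume
  have hsub : frontier (circleFract ⁻¹' I) ⊆ {0} ∪ circleFract ⁻¹' (frontier I) := by
    intro t ht
    by_cases h0 : t = 0
    · exact Or.inl h0
    · right
      have hc := continuousAt_circleFract h0
      rw [Set.mem_preimage, frontier_eq_closure_inter_closure]
      rw [frontier_eq_closure_inter_closure] at ht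
      refine ⟨?_, ?_⟩
      · exact mem_closure_iff_frequently.2
          (hc.tendsto.frequently (mem_closure_iff_frequently.1 ht.1))
      · exact mem_closure_iff_frequently.2
          (hc.tendsto.frequently (mem_closure_iff_frequently.1 ht.2))
  refine measure_mono_null hsub (measure_union_null ?_ ?_)
  · refine measure_mono_null (t := circleFract ⁻¹' {0}) ?_ ?_
    · rintro _ rfl
      simpa using circleFract_coe 0
    · rw [volume_preimage_circleFract (measurableSet_singleton 0) (by simp), Real.volume_singleton]
  have hIc : frontier I ⊆ Set.Icc 0 1 :=
    frontier_subset_closure.trans (closure_minimal hI1 isClosed_Icc)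
  rw [volume_preimage_circleFract isClosed_frontier.measurableSet hIc, hfr]

theorem integral_fourier_eq_zero {n : ℤ} (hn : n ≠ 0) :
    ∫ t : UnitAddCircle, fourier n t = 0 :=
  integral_eq_zero_of_add_right_eq_neg (fourier_add_half_inv_index hn one_pos)

theorem integral_mFourier_eq_zero {d : ℕ} {m : Fin d → ℤ} (hm : m ≠ 0) :
    ∫ t, UnitAddTorus.mFourier m t
      ∂(Measure.pi fun _ : Fin d => (volume : Measure UnitAddCircle)) = 0 := by
  obtain ⟨i, hi⟩ := Function.ne_iff.1 hm
  have := integral_fintype_prod_eq_prod (𝕜 := ℂ)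
    (μ := fun _ : Fin d => (volume : Measure UnitAddCircle)) (fun i t => fourier (m i) t)
  change ∫ t : Fin d → UnitAddCircle, ∏ i, fourier (m i) (t i) ∂_ = 0
  rw [this]
  exact Finset.prod_eq_zero (Finset.mem_univ i) (integral_fourier_eq_zero hi)

/-- The statement is linear in `f` and stable under uniform limits, and trigonometric polynomials
are dense. Averages are taken over `N + 1` points so that the denominator never vanishes. -/
theorem tendsto_average_of_tendsto_average_mFourier {d : ℕ} {z : ℕ → UnitAddTorus (Fin d)}
    (h : ∀ m : Fin d → ℤ, m ≠ 0 → Tendsto (fun N : ℕ =>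
      (∑ n ∈ Finset.Icc 1 (N + 1), UnitAddTorus.mFourier m (z n)) / ((N + 1 : ℕ) : ℂ))
        atTop (𝓝 0))
    (f : C(UnitAddTorus (Fin d), ℂ)) :
    Tendsto (fun N : ℕ => (∑ n ∈ Finset.Icc 1 (N + 1), f (z n)) / ((N + 1 : ℕ) : ℂ)) atTop
      (𝓝 (∫ t, f t ∂(Measure.pi fun _ : Fin d => (volume : Measure UnitAddCircle)))) := by
  set ν := Measure.pi fun _ : Fin d => (volume : Measure UnitAddCircle) with hν
  have hνu : ν Set.univ = 1 := by
    rw [hν, Measure.pi_univ]; simp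
  have : IsProbabilityMeasure ν := ⟨hνu⟩
  have hint : ∀ f : C(UnitAddTorus (Fin d), ℂ), Integrable f ν := fun f =>
    Integrable.of_bound f.continuous.aestronglyMeasurable ‖f‖ (ae_of_all _ f.norm_coe_le_norm)
  have hspan : ∀ f ∈ Submodule.span ℂ (Set.range (UnitAddTorus.mFourier (d := Fin d))),
      Tendsto (fun N : ℕ => (∑ n ∈ Finset.Icc 1 (N + 1), f (z n)) / ((N + 1 : ℕ) : ℂ)) atTop
        (𝓝 (∫ t, f t ∂ν)) := by
    intro f hf
    induction hf using Submodule.span_induction with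
    | mem f hf =>
      obtain ⟨m, rfl⟩ := hf
      by_cases hm : m = 0
      · subst hm
        rw [UnitAddTorus.mFourier_zero]
        simp only [ContinuousMap.one_apply, integral_const]
        have : ∀ N : ℕ, (∑ n ∈ Finset.Icc 1 (N + 1), (1 : ℂ)) / ((N + 1 : ℕ) : ℂ) = 1 := fun N => by
          rw [Finset.sum_const, Nat.card_Icc, Nat.add_sub_cancel, nsmul_eq_mul, mul_one, div_self]
          exact_mod_cast Nat.succ_ne_zero N
        simp_rw [this]
        simp
      · rw [integral_mFourier_eq_zero hm]
        exact h m hm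
    | zero => simp
    | add f g _ _ hf hg =>
      simp only [ContinuousMap.add_apply, Finset.sum_add_distrib, add_div]
      rw [integral_add (hint f) (hint g)]
      exact hf.add hg
    | smul c f _ hf =>
      simp only [ContinuousMap.smul_apply, smul_eq_mul, ← Finset.mul_sum, mul_div_assoc]
      rw [integral_const_mul]
      exact hf.const_mul c
  have hdense : f ∈ closure ((Submodule.span ℂ (Set.range (UnitAddTorus.mFourier (d := Fin d))) :
      Submodule ℂ C(UnitAddTorus (Fin d), ℂ)) : Set C(UnitAddTorus (Fin d), ℂ)) := by
    have := UnitAddTorus.span_mFourier_closure_eq_top (d := Fin d)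
    rw [← Submodule.topologicalClosure_coe, this]
    trivial
  rw [Metric.tendsto_atTop]
  intro ε hε
  obtain ⟨g, hg, hfg⟩ := Metric.mem_closure_iff.1 hdense (ε / 3) (by positivity)
  obtain ⟨N₀, hN₀⟩ := Metric.tendsto_atTop.1 (hspan g hg) (ε / 3) (by positivity)
  refine ⟨N₀, fun N hN => ?_⟩
  have hpt : ∀ t, ‖f t - g t‖ ≤ ε / 3 := fun t =>
    ((f - g).norm_coe_le_norm t).trans (by rw [← dist_eq_norm]; exact hfg.le)
  have e1 : ‖(∑ n ∈ Finset.Icc 1 (N + 1), f (z n)) / ((N + 1 : ℕ) : ℂ) -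
      (∑ n ∈ Finset.Icc 1 (N + 1), g (z n)) / ((N + 1 : ℕ) : ℂ)‖ ≤ ε / 3 := by
    rw [← sub_div, ← Finset.sum_sub_distrib, norm_div, Complex.norm_natCast,
      div_le_iff₀ (by positivity)]
    refine (norm_sum_le_of_le _ fun n _ => hpt (z n)).trans ?_
    simp [mul_comm]
  have e2 : ‖∫ t, g t ∂ν - ∫ t, f t ∂ν‖ ≤ ε / 3 := by
    rw [← integral_sub (hint g) (hint f)]
    have := norm_integral_le_of_norm_le_const (μ := ν) (f := fun t => g t - f t)
      (ae_of_all _ fun t => by rw [norm_sub_rev]; exact hpt t)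
    simpa using this
  have e3 := hN₀ N hN
  rw [dist_eq_norm] at e3 ⊢
  have := norm_add₃_le (a := (∑ n ∈ Finset.Icc 1 (N + 1), f (z n)) / ((N + 1 : ℕ) : ℂ) -
      (∑ n ∈ Finset.Icc 1 (N + 1), g (z n)) / ((N + 1 : ℕ) : ℂ))
    (b := (∑ n ∈ Finset.Icc 1 (N + 1), g (z n)) / ((N + 1 : ℕ) : ℂ) - ∫ t, g t ∂ν)
    (c := ∫ t, g t ∂ν - ∫ t, f t ∂ν)
  rw [sub_add_sub_cancel, sub_add_sub_cancel] at this
  linarith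

theorem mFourier_coe {d : ℕ} (m : Fin d → ℤ) (y : Fin d → ℝ) :
    UnitAddTorus.mFourier m (fun i => (y i : UnitAddCircle)) =
      Complex.exp (Complex.I * ((2 * Real.pi * ∑ i, (m i : ℝ) * y i : ℝ) : ℂ)) := by
  change ∏ i, fourier (m i) ((y i : ℝ) : UnitAddCircle) = _
  simp_rw [fourier_coe_apply]
  rw [← Complex.exp_sum]
  congr 1
  push_cast
  rw [Finset.mul_sum, Finset.mul_sum]
  refine Finset.sum_congr rfl fun i _ => ?_
  ring

/-- The multidimensional **Weyl criterion**. -/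
theorem uniformlyDistributedModOne_of_weyl {d : ℕ} {y : ℕ → Fin d → ℝ}
    (h : ∀ m : Fin d → ℤ, m ≠ 0 → Tendsto (fun N : ℕ => (∑ n ∈ Finset.Icc 1 N,
      Complex.exp (Complex.I * ((2 * Real.pi * ∑ i, (m i : ℝ) * y n i : ℝ) : ℂ))) / (N : ℂ))
        atTop (𝓝 0)) :
    UniformlyDistributedModOne y := by
  intro I hI
  set z : ℕ → UnitAddTorus (Fin d) := fun n i => (y n i : UnitAddCircle) with hz
  set ν : Measure (UnitAddTorus (Fin d)) :=
    Measure.pi fun _ : Fin d => (volume : Measure UnitAddCircle) with hν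
  have hνp : IsProbabilityMeasure ν := ⟨by
    rw [hν, Measure.pi_univ]; simp⟩
  have havg := tendsto_average_of_tendsto_average_mFourier (z := z) fun m hm => by
    have := (tendsto_add_atTop_iff_nat 1).2 (h m hm)
    simpa only [hz, mFourier_coe] using this
  set E : Set (UnitAddTorus (Fin d)) := Set.univ.pi fun i => circleFract ⁻¹' (I i) with hE
  have hIm : ∀ i, MeasurableSet (I i) := fun i => (hI i).1.measurableSet
  have hEm : MeasurableSet E := MeasurableSet.univ_pi fun i => measurable_circleFract (hIm i)
  have hνE : ν E = volume (Set.univ.pi I) := by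
    rw [hν, hE, Measure.pi_pi, volume_pi, Measure.pi_pi]
    exact Finset.prod_congr rfl fun i _ => volume_preimage_circleFract (hIm i) (hI i).2
  have hfr : ν (frontier E) = 0 := by
    have hsub : frontier E ⊆ ⋃ i, Function.eval i ⁻¹' frontier (circleFract ⁻¹' (I i)) := by
      intro t ht
      rw [frontier, hE, closure_pi_set, interior_pi_set Set.finite_univ] at ht
      obtain ⟨h1, h2⟩ := ht
      simp only [Set.mem_univ_pi, not_forall] at h1 h2
      obtain ⟨i, hi⟩ := h2
      exact Set.mem_iUnion.2 ⟨i, h1 i, hi⟩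
    refine measure_mono_null hsub (measure_iUnion_null fun i => ?_)
    exact Measure.pi_eval_preimage_null _ (volume_frontier_preimage_circleFract (hI i).1 (hI i).2)
  -- Empirical measures. They converge weakly to Haar measure, so the portmanteau theorem applies to
  -- the box, whose frontier is null.
  set μs : ℕ → Measure (UnitAddTorus (Fin d)) := fun N =>
    ((N + 1 : ℕ) : ENNReal)⁻¹ • ∑ n ∈ Finset.Icc 1 (N + 1), Measure.dirac (z n) with hμs
  have hμE : ∀ N (S : Set (UnitAddTorus (Fin d))), MeasurableSet S → μs N S =
      ((N + 1 : ℕ) : ENNReal)⁻¹ * ({n : ℕ | n ∈ Set.Icc 1 (N + 1) ∧ z n ∈ S}.ncard : ENNReal) := by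
    classical
    intro N S hS
    simp only [hμs, Measure.smul_apply, Measure.finsetSum_apply, smul_eq_mul,
      Measure.dirac_apply' _ hS]
    congr 1
    have : {n : ℕ | n ∈ Set.Icc 1 (N + 1) ∧ z n ∈ S} =
        (((Finset.Icc 1 (N + 1)).filter fun n => z n ∈ S : Finset ℕ) : Set ℕ) := by
      ext n; simp
    rw [this, Set.ncard_coe_finset, Finset.card_filter]
    push_cast
    refine Finset.sum_congr rfl fun n _ => ?_
    simp [Set.indicator_apply]
  have hμp : ∀ N, IsProbabilityMeasure (μs N) := fun N => ⟨by
    rw [hμE N _ MeasurableSet.univ]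
    have : {n : ℕ | n ∈ Set.Icc 1 (N + 1) ∧ z n ∈ Set.univ} =
        ((Finset.Icc 1 (N + 1) : Finset ℕ) : Set ℕ) := by ext n; simp
    rw [this, Set.ncard_coe_finset, Nat.card_Icc, Nat.add_sub_cancel]
    exact ENNReal.inv_mul_cancel (by simp) (ENNReal.natCast_ne_top _)⟩
  obtain ⟨P, hP⟩ : ∃ P : ℕ → ProbabilityMeasure (UnitAddTorus (Fin d)),
      ∀ N, (P N : Measure (UnitAddTorus (Fin d))) = μs N :=
    ⟨fun N => ⟨μs N, hμp N⟩, fun _ => rfl⟩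
  obtain ⟨Q, hQ⟩ : ∃ Q : ProbabilityMeasure (UnitAddTorus (Fin d)),
      (Q : Measure (UnitAddTorus (Fin d))) = ν := ⟨⟨ν, hνp⟩, rfl⟩
  have hlim : Tendsto P atTop (𝓝 Q) := by
    rw [ProbabilityMeasure.tendsto_iff_forall_integral_rclike_tendsto ℂ, hQ]
    intro f
    refine (havg f.toContinuousMap).congr fun N => ?_
    rw [hP, hμs, integral_smul_measure, integral_finsetSum_measure fun n _ => integrable_dirac (by simp)]
    simp only [integral_dirac]
    rw [ENNReal.toReal_inv, ENNReal.toReal_natCast, Complex.real_smul, div_eq_inv_mul]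
    push_cast
    rfl
  have hfin := ProbabilityMeasure.tendsto_measure_of_null_frontier_of_tendsto' hlim (E := E) (by rw [hQ, hfr])
  simp only [hP, hQ] at hfin
  have hfin' := (ENNReal.tendsto_toReal (measure_ne_top ν E)).comp hfin
  rw [hνE] at hfin'
  refine (tendsto_add_atTop_iff_nat 1).1 (hfin'.congr fun N => ?_)
  simp only [Function.comp, hμE N E hEm, ENNReal.toReal_mul, ENNReal.toReal_inv,
    ENNReal.toReal_natCast, one_div]
  congr 3
  ext n
  simp [hE, hz, circleFract_coe]

/-! ### Polynomial phases. -/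

theorem iteratedDeriv_polynomial_eval (Q : ℝ[X]) (r : ℕ) :
    iteratedDeriv r (fun x => Q.eval x) = fun x => (derivative^[r] Q).eval x := by
  induction r generalizing Q with
  | zero => simp
  | succ r ih =>
    have : deriv (fun x => Q.eval x) = fun x => (derivative Q).eval x := by
      ext x; exact Q.deriv
    rw [iteratedDeriv_succ', this, ih, Function.iterate_succ_apply]

theorem eval_iterate_derivative_eq_sum {Q : ℝ[X]} {d : ℕ} (hQ : Q.natDegree ≤ d) (j : ℕ) (x : ℝ) :
    (derivative^[j] Q).eval x =
      ∑ m ∈ Finset.range (d + 1), ((m + j).descFactorial j : ℝ) * Q.coeff (m + j) * x ^ m := by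
  rw [eval_eq_sum_range' (n := d + 1)]
  · simp [coeff_iterate_derivative]
  · exact Nat.lt_succ_of_le
      ((natDegree_iterate_derivative Q j).trans ((Nat.sub_le _ _).trans hQ))

theorem abs_descFactorial_mul_coeff_le {Q : ℝ[X]} {d j m : ℕ} (hQ : Q.natDegree ≤ d) {A : ℝ}
    (hj : j ≤ d) (hA : 0 ≤ A) (hc : m + j ≤ d → |Q.coeff (m + j)| ≤ A) :
    |((m + j).descFactorial j : ℝ) * Q.coeff (m + j)| ≤ (d : ℝ) ^ d * A := by
  by_cases hm : m + j ≤ d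
  · rw [abs_mul, Nat.abs_cast]
    refine mul_le_mul ?_ (hc hm) (abs_nonneg _) (by positivity)
    have h1 : (m + j).descFactorial j ≤ d ^ d := by
      rcases Nat.eq_zero_or_pos d with h0 | h0
      · have : m = 0 ∧ j = 0 := by omega
        simp [this.1, this.2, h0]
      · exact (Nat.descFactorial_le_pow _ _).trans
          ((Nat.pow_le_pow_left hm j).trans (Nat.pow_le_pow_right h0 hj))
    exact_mod_cast h1
  · rw [coeff_eq_zero_of_natDegree_lt (by omega), mul_zero, abs_zero]
    positivity

/-- A polynomial with a large coefficient has, on a bounded interval, a large derivative of some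
positive order, while the coefficients of higher degree are controlled. -/
theorem exists_order_large_derivative (d : ℕ) {R : ℝ} (hR : 1 ≤ R) :
    ∃ K : ℝ, 1 ≤ K ∧ ∀ (Q : ℝ[X]) (M : ℝ), Q.natDegree ≤ d → (∃ i ∈ Finset.Icc 1 d, M ≤ |Q.coeff i|) →
      ∃ j ∈ Finset.Icc 1 d, ∃ q : ℝ, M / K ≤ q ∧ (∀ i, j ≤ i → |Q.coeff i| ≤ q) ∧
        ∀ x, |x| ≤ R → q / 2 ≤ |(derivative^[j] Q).eval x| := by
  set D : ℝ := (d : ℝ) ^ d with hD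
  have hD0 : 0 ≤ D := by positivity
  -- Chosen so that at most `d` terms of size `D * q * R / K` add up to at most `q / 2`.
  set K : ℝ := 2 * (d + 1) * (D + 1) * R with hK
  have hKR : R ≤ K := by
    have : 1 ≤ 2 * ((d : ℝ) + 1) * (D + 1) := by
      nlinarith [mul_nonneg (Nat.cast_nonneg d : (0 : ℝ) ≤ d) hD0, (Nat.cast_nonneg d : (0 : ℝ) ≤ d)]
    nlinarith
  have hK1 : 1 ≤ K := hR.trans hKR
  have hK0 : 0 < K := by linarith
  refine ⟨K ^ d, one_le_pow₀ hK1, fun Q M hQ ⟨i₀, hi₀, hM⟩ => ?_⟩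
  -- Maximising with weights `K ^ i` forces the coefficient of degree `j + m` to be at most `q / K ^
  -- m`, so the constant term of the `j`-th derivative dominates the others on `[-R, R]`.
  obtain ⟨j, hj, hmax⟩ := Finset.exists_max_image (Finset.Icc 1 d) (fun i => |Q.coeff i| * K ^ i)
    ⟨i₀, hi₀⟩
  have hj' := Finset.mem_Icc.1 hj
  set q := |Q.coeff j| with hq
  have hq0 : 0 ≤ q := abs_nonneg _
  have hdec : ∀ m, m + j ≤ d → |Q.coeff (m + j)| * K ^ m ≤ q := fun m hm => by
    have := hmax (m + j) (Finset.mem_Icc.2 ⟨by omega, hm⟩)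
    simp only [pow_add, ← mul_assoc] at this
    exact le_of_mul_le_mul_right this (by positivity)
  refine ⟨j, hj, q, ?_, fun i hi => ?_, fun x hx => ?_⟩
  · rw [div_le_iff₀ (by positivity)]
    calc M ≤ |Q.coeff i₀| := hM
      _ ≤ |Q.coeff i₀| * K ^ i₀ := le_mul_of_one_le_right (abs_nonneg _) (one_le_pow₀ hK1)
      _ ≤ q * K ^ j := hmax i₀ hi₀
      _ ≤ q * K ^ d := by gcongr; exact hj'.2
  · obtain ⟨m, rfl⟩ := Nat.exists_eq_add_of_le' hi
    by_cases hm : m + j ≤ d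
    · exact (le_mul_of_one_le_right (abs_nonneg _) (one_le_pow₀ hK1)).trans (hdec m hm)
    · rw [coeff_eq_zero_of_natDegree_lt (by omega), abs_zero]; exact hq0
  · rw [eval_iterate_derivative_eq_sum hQ, Finset.sum_range_succ']
    have htop : q ≤ |((0 + j).descFactorial j : ℝ) * Q.coeff (0 + j) * x ^ 0| := by
      rw [zero_add, pow_zero, mul_one, abs_mul, Nat.abs_cast, Nat.descFactorial_self]
      exact le_mul_of_one_le_left hq0 (by exact_mod_cast Nat.one_le_iff_ne_zero.2 (Nat.factorial_ne_zero j))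
    have hrest : |∑ m ∈ Finset.range d, ((m + 1 + j).descFactorial j : ℝ) * Q.coeff (m + 1 + j) *
        x ^ (m + 1)| ≤ q / 2 := by
      have hterm : ∀ m ∈ Finset.range d, |((m + 1 + j).descFactorial j : ℝ) * Q.coeff (m + 1 + j) *
          x ^ (m + 1)| ≤ D * (q * (R / K)) := fun m _ => by
        have h1 := abs_descFactorial_mul_coeff_le (m := m + 1) (A := q / K ^ (m + 1)) hQ hj'.2
          (by positivity) (fun hm => by
            rw [le_div_iff₀ (by positivity)]; exact hdec (m + 1) hm)
        rw [abs_mul, abs_pow]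
        calc _ ≤ D * (q / K ^ (m + 1)) * R ^ (m + 1) := by gcongr
          _ = D * (q * (R / K) ^ (m + 1)) := by rw [div_pow]; ring
          _ ≤ D * (q * (R / K)) := by
            gcongr
            exact pow_le_of_le_one (by positivity) ((div_le_one hK0).2 hKR) (by omega)
      refine (Finset.abs_sum_le_sum_abs _ _).trans ((Finset.sum_le_sum hterm).trans ?_)
      rw [Finset.sum_const, Finset.card_range, nsmul_eq_mul]
      have hRK : R / K = 1 / (2 * (d + 1) * (D + 1)) := by
        rw [hK]; field_simp
      rw [hRK]
      have : (d : ℝ) * (D * (q * (1 / (2 * (d + 1) * (D + 1))))) =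
          (d / (d + 1)) * (D / (D + 1)) * (q / 2) := by field_simp
      rw [this]
      have a1 : (d : ℝ) / (d + 1) ≤ 1 := (div_le_one (by positivity)).2 (by linarith)
      have a2 : D / (D + 1) ≤ 1 := (div_le_one (by positivity)).2 (by linarith)
      have a3 := mul_le_one₀ a1 (by positivity) a2
      nlinarith
    have := abs_sub_abs_le_abs_sub (((0 + j).descFactorial j : ℝ) * Q.coeff (0 + j) * x ^ 0)
      (-∑ m ∈ Finset.range d, ((m + 1 + j).descFactorial j : ℝ) * Q.coeff (m + 1 + j) * x ^ (m + 1))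
    rw [abs_neg, sub_neg_eq_add, add_comm (((0 + j).descFactorial j : ℝ) * _ * _)] at this
    linarith

theorem contDiff_polynomial_eval (Q : ℝ[X]) {n : WithTop ℕ∞} :
    ContDiff ℝ n fun x : ℝ => Q.eval x := by
  simpa using Q.contDiff_aeval (𝕜 := ℝ) n

/-- Decay of oscillatory integrals with polynomial phase, uniform in the polynomial. -/
theorem exists_norm_integral_exp_polynomial_le {d : ℕ} (hd : 1 ≤ d) {R : ℝ} (hR : 1 ≤ R) :
    ∃ C : ℝ, 0 ≤ C ∧ ∀ (Q : ℝ[X]) (M a b : ℝ), Q.natDegree ≤ d → 0 < M →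
      (∃ i ∈ Finset.Icc 1 d, M ≤ |Q.coeff i|) → -R ≤ a → a ≤ b → b ≤ R →
      ‖∫ x in a..b, Complex.exp (Complex.I * ((Q.eval x : ℝ) : ℂ))‖ ≤ C * M ^ (-(1 : ℝ) / d) := by
  obtain ⟨K, hK1, hK⟩ := exists_order_large_derivative d hR
  have hK0 : 0 < K := by linarith
  have hd0 : (0 : ℝ) < d := by exact_mod_cast hd
  choose! c hc0 hc using fun r (hr : 2 ≤ r) => van_der_corput hr
  set B : ℝ := (d + 1) * ((d : ℝ) ^ d * R ^ d) with hB
  have hB0 : 0 ≤ B := by positivity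
  set C₂ : ℝ := ∑ r ∈ Finset.Icc 2 d, c r * (2 * K) with hC₂
  have hC₂' : ∀ r ∈ Finset.Icc 2 d, 0 ≤ c r * (2 * K) := fun r hr =>
    mul_nonneg (hc0 r (Finset.mem_Icc.1 hr).1) (by positivity)
  have hC₂0 : 0 ≤ C₂ := Finset.sum_nonneg hC₂'
  refine ⟨2 * R + C₂ + (4 + 8 * R * B) * K, by positivity, fun Q M a b hQ hM hex ha hab hb => ?_⟩
  have hMd : 0 ≤ M ^ (-(1 : ℝ) / d) := by positivity
  have hfin : ∀ {T u : ℝ}, T ≤ u * M ^ (-(1 : ℝ) / d) → u ≤ 2 * R + C₂ + (4 + 8 * R * B) * K →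
      T ≤ (2 * R + C₂ + (4 + 8 * R * B) * K) * M ^ (-(1 : ℝ) / d) := fun h1 h2 =>
    h1.trans (mul_le_mul_of_nonneg_right h2 hMd)
  have hC₁0 : 0 ≤ (4 + 8 * R * B) * K := by positivity
  -- For `M < 1` the claimed bound exceeds the length of the interval; for `M ≥ 1` the exponent `-1
  -- / d` is the weakest among orders `j ≤ d`.
  rcases lt_or_ge M 1 with hM1 | hM1
  · refine hfin (u := 2 * R) ?_ (by linarith)
    refine (norm_integral_exp_le_length _ hab).trans ?_
    have : 1 ≤ M ^ (-(1 : ℝ) / d) := by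
      refine Real.one_le_rpow_of_pos_of_le_one_of_nonpos hM hM1.le ?_
      rw [neg_div]; exact neg_nonpos.2 (by positivity)
    nlinarith
  have hexp : ∀ j : ℕ, 1 ≤ j → j ≤ d → M ^ (-(1 : ℝ) / j) ≤ M ^ (-(1 : ℝ) / d) := fun j hj hjd => by
    apply Real.rpow_le_rpow_of_exponent_le hM1
    rw [neg_div, neg_div, neg_le_neg_iff]
    exact one_div_le_one_div_of_le (by exact_mod_cast hj) (by exact_mod_cast hjd)
  obtain ⟨j, hj, q, hMq, hcoef, hlow⟩ := hK Q M hQ hex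
  have hj' := Finset.mem_Icc.1 hj
  have hq0 : 0 < q := lt_of_lt_of_le (by positivity) hMq
  have habs : ∀ x ∈ Set.Icc a b, |x| ≤ R := fun x hx =>
    abs_le.2 ⟨ha.trans hx.1, hx.2.trans hb⟩
  -- Order one would need a sign for the second derivative. Control of the higher coefficients by
  -- `q` bounds that derivative by `B * q` instead.
  rcases hj'.1.eq_or_lt with rfl | hj2
  · refine hfin (u := (4 + 8 * R * B) * K) ?_ (by linarith)
    have hder : deriv (fun x => Q.eval x) = fun x => (derivative Q).eval x := by
      ext x; exact Q.deriv
    have hder2 : deriv (deriv fun x => Q.eval x) = fun x => (derivative^[2] Q).eval x := by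
      rw [hder]; ext x; exact (derivative Q).deriv
    have h1 := norm_integral_exp_le_of_le_abs_deriv (f := fun x => Q.eval x) (lam := q / 2)
      (B := B * q) (contDiff_polynomial_eval Q) hab (by positivity)
      (fun x hx => by rw [hder]; exact hlow x (habs x hx))
      (fun x hx => by
        rw [hder2]
        simp only
        rcases Nat.lt_or_ge d 2 with hd2 | hd2
        · rw [iterate_derivative_eq_zero (by omega), eval_zero, abs_zero]; positivity
        rw [eval_iterate_derivative_eq_sum hQ]
        refine (Finset.abs_sum_le_sum_abs _ _).trans ?_
        refine (Finset.sum_le_sum (g := fun _ => (d : ℝ) ^ d * q * R ^ d) fun m hm => ?_).trans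
          (le_of_eq ?_)
        · rw [abs_mul, abs_pow]
          have := abs_descFactorial_mul_coeff_le (m := m) (A := q) hQ hd2 hq0.le
            (fun _ => hcoef (m + 2) (by omega))
          have hxm : |x| ^ m ≤ R ^ d :=
            (pow_le_pow_left₀ (abs_nonneg _) (habs x hx) m).trans
              (pow_le_pow_right₀ hR (Nat.lt_succ_iff.1 (Finset.mem_range.1 hm)))
          gcongr
        · rw [Finset.sum_const, Finset.card_range, nsmul_eq_mul, hB]; push_cast; ring)
    refine h1.trans ?_
    have h2 : 2 / (q / 2) + (b - a) * (B * q) / (q / 2) ^ 2 = (4 + 4 * (b - a) * B) / q := by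
      field_simp; ring
    rw [h2]
    calc (4 + 4 * (b - a) * B) / q ≤ (4 + 8 * R * B) / (M / K) := by
          refine div_le_div₀ (by positivity) ?_ (by positivity) hMq
          nlinarith
      _ = (4 + 8 * R * B) * K * M ^ (-(1 : ℝ) / (1 : ℕ)) := by
          norm_num [Real.rpow_neg_one]; field_simp
      _ ≤ _ := by
          have := hexp 1 le_rfl hd
          gcongr
  · refine hfin (u := c j * (2 * K)) ?_ ?_
    · have h1 := hc j hj2 (fun x => Q.eval x) a b (q / 2) (contDiff_polynomial_eval Q) hab
        (by positivity) (fun x hx => by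
          rw [iteratedDeriv_polynomial_eval]; exact hlow x (habs x hx))
      refine h1.trans ?_
      rw [mul_assoc]
      refine mul_le_mul_of_nonneg_left ?_ (hc0 j hj2)
      have hj0 : (0 : ℝ) < j := by exact_mod_cast hj'.1
      calc (q / 2) ^ (-(1 : ℝ) / j) ≤ (M / (2 * K)) ^ (-(1 : ℝ) / j) := by
            apply Real.rpow_le_rpow_of_nonpos (by positivity)
            · rw [mul_comm 2 K, ← div_div]; gcongr
            · rw [neg_div]; exact neg_nonpos.2 (by positivity)
        _ = (2 * K) ^ ((1 : ℝ) / j) * M ^ (-(1 : ℝ) / j) := by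
            rw [Real.div_rpow hM.le (by positivity), neg_div, Real.rpow_neg (by positivity : 0 ≤ 2 * K),
              div_inv_eq_mul, mul_comm]
        _ ≤ (2 * K) * M ^ (-(1 : ℝ) / d) := by
            have e1 := hexp j hj'.1 hj'.2
            have e2 : (2 * K) ^ ((1 : ℝ) / j) ≤ 2 * K := by
              have := Real.rpow_le_rpow_of_exponent_le (x := 2 * K) (by linarith)
                (show (1 : ℝ) / j ≤ 1 from (div_le_one hj0).2 (by exact_mod_cast hj'.1))
              rwa [Real.rpow_one] at this
            gcongr
    · have := Finset.single_le_sum hC₂' (Finset.mem_Icc.2 ⟨hj2, hj'.2⟩)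
      have hR0 : 0 ≤ 2 * R := by linarith
      linarith

/-! ### Phases built from large exponentials. -/

/-- The coefficient of `b ^ j` in `exp (-b G) * (d/dx)^r exp (b G)`. -/
noncomputable def expCoeff (G : ℝ → ℝ) : ℕ → ℕ → ℝ → ℝ
  | 0, 0 => fun _ => 1
  | 0, _ + 1 => fun _ => 0
  | r + 1, 0 => deriv (expCoeff G r 0)
  | r + 1, j + 1 => fun x => deriv (expCoeff G r (j + 1)) x + deriv G x * expCoeff G r j x

theorem contDiff_expCoeff {G : ℝ → ℝ} (hG : ContDiff ℝ (⊤ : ℕ∞) G) (r j : ℕ) :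
    ContDiff ℝ (⊤ : ℕ∞) (expCoeff G r j) := by
  induction r generalizing j with
  | zero => cases j <;> exact contDiff_const
  | succ r ih =>
    cases j with
    | zero => exact (contDiff_infty_iff_deriv.1 (ih 0)).2
    | succ j =>
      exact (contDiff_infty_iff_deriv.1 (ih (j + 1))).2.add
        ((contDiff_infty_iff_deriv.1 hG).2.mul (ih j))

theorem expCoeff_of_lt (G : ℝ → ℝ) {r j : ℕ} (h : r < j) : expCoeff G r j = fun _ => 0 := by
  induction r generalizing j with
  | zero => obtain ⟨j, rfl⟩ := Nat.exists_eq_succ_of_ne_zero h.ne'; rfl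
  | succ r ih =>
    obtain ⟨j, rfl⟩ := Nat.exists_eq_succ_of_ne_zero (Nat.ne_zero_of_lt h)
    ext x
    change deriv (expCoeff G r (j + 1)) x + deriv G x * expCoeff G r j x = 0
    rw [ih (by omega), ih (by omega)]
    simp

theorem expCoeff_self (G : ℝ → ℝ) (r : ℕ) : expCoeff G r r = fun x => deriv G x ^ r := by
  induction r with
  | zero => ext x; simp [expCoeff]
  | succ r ih =>
    ext x
    change deriv (expCoeff G r (r + 1)) x + deriv G x * expCoeff G r r x = _
    rw [ih, expCoeff_of_lt G (Nat.lt_succ_self r)]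
    simp [pow_succ']

theorem iteratedDeriv_exp_mul {G : ℝ → ℝ} (hG : ContDiff ℝ (⊤ : ℕ∞) G) (b : ℝ) (r : ℕ) :
    iteratedDeriv r (fun x => Real.exp (b * G x)) =
      fun x => Real.exp (b * G x) * ∑ j ∈ Finset.range (r + 1), expCoeff G r j x * b ^ j := by
  induction r with
  | zero => ext x; simp [expCoeff]
  | succ r ih =>
    rw [iteratedDeriv_succ, ih]
    ext x
    have hGd : HasDerivAt G (deriv G x) x := ((hG.differentiable (by norm_num)) x).hasDerivAt
    have hcd : ∀ j, HasDerivAt (expCoeff G r j) (deriv (expCoeff G r j) x) x := fun j =>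
      (((contDiff_expCoeff hG r j).differentiable (by norm_num)) x).hasDerivAt
    have h1 := ((hGd.const_mul b).exp).mul
      (HasDerivAt.fun_sum (u := Finset.range (r + 1)) fun j _ => (hcd j).mul_const (b ^ j))
    refine h1.deriv.trans ?_
    -- The vanishing coefficient of index `r + 1` lets the sum be shifted by one to match the
    -- product rule.
    have hlast : deriv (expCoeff G r (r + 1)) x = 0 := by
      rw [expCoeff_of_lt G (Nat.lt_succ_self r)]; simp
    have h2 : ∑ j ∈ Finset.range (r + 1 + 1), expCoeff G (r + 1) j x * b ^ j =
        ∑ j ∈ Finset.range (r + 1), deriv (expCoeff G r j) x * b ^ j +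
          b * deriv G x * ∑ j ∈ Finset.range (r + 1), expCoeff G r j x * b ^ j := by
      rw [Finset.sum_range_succ']
      have h3 : ∑ j ∈ Finset.range (r + 1), deriv (expCoeff G r j) x * b ^ j =
          ∑ j ∈ Finset.range (r + 1), deriv (expCoeff G r (j + 1)) x * b ^ (j + 1) +
            deriv (expCoeff G r 0) x * b ^ 0 := by
        rw [← Finset.sum_range_succ' (fun j => deriv (expCoeff G r j) x * b ^ j),
          Finset.sum_range_succ _ (r + 1), hlast, zero_mul, add_zero]
      rw [h3, Finset.mul_sum, add_right_comm, ← Finset.sum_add_distrib]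
      congr 1
      refine Finset.sum_congr rfl fun j _ => ?_
      simp only [expCoeff]
      ring
    rw [h2]
    ring

/-- Derivatives of `exp (b G)` for different large `b` are separated. -/
theorem exists_abs_sub_le_iteratedDeriv_exp_sub {G : ℝ → ℝ} (hG : ContDiff ℝ (⊤ : ℕ∞) G)
    {α β g₀ g₁ : ℝ} (hg₀ : 0 < g₀) (hg₁ : 0 < g₁) (h0 : ∀ x ∈ Set.Icc α β, g₀ ≤ G x)
    (h1 : ∀ x ∈ Set.Icc α β, g₁ ≤ |deriv G x|) {r : ℕ} (hr : 1 ≤ r) :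
    ∃ B : ℝ, ∀ b b' : ℝ, B ≤ b → B ≤ b' → ∀ x ∈ Set.Icc α β,
      |b - b'| ≤ |iteratedDeriv r (fun x => Real.exp (b * G x)) x -
        iteratedDeriv r (fun x => Real.exp (b' * G x)) x| := by
  obtain ⟨s, rfl⟩ := Nat.exists_eq_add_of_le' hr
  set r := s + 1 with hrs
  have hbd : ∀ j, ∃ A : ℝ, ∀ x ∈ Set.Icc α β, |expCoeff G r j x| ≤ A := fun j =>
    isCompact_Icc.exists_bound_of_continuousOn (contDiff_expCoeff hG r j).continuous.continuousOn
  choose A hA using hbd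
  obtain ⟨A', hA'⟩ := isCompact_Icc.exists_bound_of_continuousOn
    (s := Set.Icc α β) hG.continuous.continuousOn
  set L : ℝ := ∑ j ∈ Finset.range r, |A' * A j| + ∑ j ∈ Finset.range (r + 1), |A j * j| with hL
  have hL0 : 0 ≤ L := by positivity
  have hgg : 0 < g₀ * g₁ ^ r := by positivity
  -- Past this threshold the leading term `G * (G') ^ r * t ^ r` exceeds all the others, bounded by
  -- `L * t ^ (r - 1)`, by at least `t ^ (r - 1) ≥ 1`.
  refine ⟨max 1 ((L + 1) / (g₀ * g₁ ^ r)), fun b b' hb hb' x hx => ?_⟩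
  -- The expression is the derivative with respect to the parameter `t`, at fixed `x`; the mean
  -- value theorem in `t` then separates `b` from `b'`.
  have hmain : ∀ t : ℝ, max 1 ((L + 1) / (g₀ * g₁ ^ r)) ≤ t →
      1 ≤ |Real.exp (t * G x) * G x * ∑ j ∈ Finset.range (r + 1), expCoeff G r j x * t ^ j +
        Real.exp (t * G x) * ∑ j ∈ Finset.range (r + 1), expCoeff G r j x * (j * t ^ (j - 1))| := by
    intro t ht
    have ht1 : 1 ≤ t := (le_max_left _ _).trans ht
    have ht2 : L + 1 ≤ g₀ * g₁ ^ r * t := by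
      have := (le_max_right _ _).trans ht
      rw [div_le_iff₀ hgg] at this; linarith
    have hGx := h0 x hx
    have hGx0 : 0 < G x := by linarith
    rw [mul_assoc, ← mul_add, abs_mul, abs_of_pos (Real.exp_pos _)]
    have he : 1 ≤ Real.exp (t * G x) := Real.one_le_exp (by positivity)
    refine one_le_mul_of_one_le_of_one_le he ?_
    rw [Finset.sum_range_succ, mul_add, expCoeff_self]
    have hlead : g₀ * g₁ ^ r * t * t ^ s ≤ |G x * (deriv G x ^ r * t ^ r)| := by
      rw [abs_mul, abs_mul, abs_pow, abs_pow, abs_of_pos hGx0, abs_of_pos (by linarith : 0 < t)]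
      have := h1 x hx
      calc g₀ * g₁ ^ r * t * t ^ s = g₀ * (g₁ ^ r * t ^ r) := by rw [hrs]; ring
        _ ≤ _ := by gcongr
    have hl1 : |G x * ∑ j ∈ Finset.range r, expCoeff G r j x * t ^ j| ≤
        (∑ j ∈ Finset.range r, |A' * A j|) * t ^ s := by
      rw [Finset.mul_sum, Finset.sum_mul]
      refine (Finset.abs_sum_le_sum_abs _ _).trans (Finset.sum_le_sum fun j hj => ?_)
      have e1 := hA j x hx
      have e2 := hA' x hx
      rw [Real.norm_eq_abs] at e2
      have e3 : t ^ j ≤ t ^ s :=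
        pow_le_pow_right₀ ht1 (by have := Finset.mem_range.1 hj; omega)
      rw [abs_mul, abs_mul, abs_of_nonneg (by positivity : 0 ≤ t ^ j), ← mul_assoc, abs_mul]
      have e4 := e1.trans (le_abs_self _)
      have e5 := e2.trans (le_abs_self _)
      gcongr
    have hl2 : |∑ j ∈ Finset.range (r + 1), expCoeff G r j x * (j * t ^ (j - 1))| ≤
        (∑ j ∈ Finset.range (r + 1), |A j * j|) * t ^ s := by
      rw [Finset.sum_mul]
      refine (Finset.abs_sum_le_sum_abs _ _).trans (Finset.sum_le_sum fun j hj => ?_)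
      have e1 := (hA j x hx).trans (le_abs_self _)
      have e3 : t ^ (j - 1) ≤ t ^ s :=
        pow_le_pow_right₀ ht1 (by have := Finset.mem_range.1 hj; omega)
      rw [abs_mul, abs_mul, Nat.abs_cast, abs_of_nonneg (by positivity : 0 ≤ t ^ (j - 1)),
        ← mul_assoc, abs_mul, Nat.abs_cast]
      gcongr
    have hts : 1 ≤ t ^ s := one_le_pow₀ ht1
    have hLs : (L + 1) * t ^ s ≤ g₀ * g₁ ^ r * t * t ^ s := by gcongr
    set U := G x * ∑ j ∈ Finset.range r, expCoeff G r j x * t ^ j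
    set V := G x * (deriv G x ^ r * t ^ r)
    set W := ∑ j ∈ Finset.range (r + 1), expCoeff G r j x * (j * t ^ (j - 1))
    have htri : |V| ≤ |U + V + W| + |U| + |W| := by
      calc |V| = |(U + V + W) - U - W| := by congr 1; ring
        _ ≤ |(U + V + W) - U| + |W| := abs_sub _ _
        _ ≤ _ := by gcongr; exact abs_sub _ _
    have : L * t ^ s = (∑ j ∈ Finset.range r, |A' * A j|) * t ^ s +
        (∑ j ∈ Finset.range (r + 1), |A j * j|) * t ^ s := by rw [hL]; ring
    linarith
  have hder : ∀ t : ℝ, HasDerivAt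
      (fun t => Real.exp (t * G x) * ∑ j ∈ Finset.range (r + 1), expCoeff G r j x * t ^ j)
      (Real.exp (t * G x) * G x * ∑ j ∈ Finset.range (r + 1), expCoeff G r j x * t ^ j +
        Real.exp (t * G x) * ∑ j ∈ Finset.range (r + 1), expCoeff G r j x * (j * t ^ (j - 1))) t := by
    intro t
    have e1 : HasDerivAt (fun t => t * G x) (G x) t := by
      simpa using (hasDerivAt_id t).mul_const (G x)
    exact e1.exp.mul (HasDerivAt.fun_sum fun j _ => (hasDerivAt_pow j t).const_mul _)
  have key := mul_abs_sub_le_of_le_abs_deriv (a := max 1 ((L + 1) / (g₀ * g₁ ^ r))) (b := max b b')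
    (lam := 1) (fun t _ => hder t) (fun t ht => hmain t ht.1) (x := b) (y := b')
    ⟨hb, le_max_left _ _⟩ ⟨hb', le_max_right _ _⟩
  rw [iteratedDeriv_exp_mul hG, iteratedDeriv_exp_mul hG]
  simpa using key

/-- Oscillatory integrals whose phase is a difference of large exponentials plus a polynomial. -/
theorem exists_norm_integral_exp_exp_sub_le {G : ℝ → ℝ} (hG : ContDiff ℝ (⊤ : ℕ∞) G)
    {α β g₀ g₁ : ℝ} (hαβ : α ≤ β) (hg₀ : 0 < g₀) (hg₁ : 0 < g₁)
    (h0 : ∀ x ∈ Set.Icc α β, g₀ ≤ G x)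
    (h1 : ∀ x ∈ Set.Icc α β, g₁ ≤ |deriv G x|) {d : ℕ} (hd : 1 ≤ d) :
    ∃ B C : ℝ, 0 ≤ C ∧ ∀ (b b' c : ℝ) (Q : ℝ[X]), B ≤ b → B ≤ b' → b ≠ b' → 1 ≤ |c| →
      Q.natDegree ≤ d →
      ‖∫ x in α..β, Complex.exp (Complex.I *
        ((c * (Real.exp (b * G x) - Real.exp (b' * G x)) + Q.eval x : ℝ) : ℂ))‖ ≤
        C * |b - b'| ^ (-(1 : ℝ) / (d + 1 : ℕ)) := by
  -- Order `d + 1` annihilates `Q` and is at least `2`, so no sign condition is needed.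
  obtain ⟨B, hB⟩ := exists_abs_sub_le_iteratedDeriv_exp_sub hG hg₀ hg₁ h0 h1 (r := d + 1) (by omega)
  obtain ⟨C, hC0, hC⟩ := van_der_corput (r := d + 1) (by omega)
  refine ⟨B, C, hC0, fun b b' c Q hb hb' hbb hc hQ => ?_⟩
  have hE : ∀ (b : ℝ) {n : WithTop ℕ∞}, n ≤ (⊤ : ℕ∞) → ContDiff ℝ n fun x => Real.exp (b * G x) :=
    fun b n hn => ((contDiff_const.mul (hG.of_le hn)).exp)
  refine hC _ α β |b - b'| ?_ hαβ (abs_pos.2 (sub_ne_zero.2 hbb)) fun x hx => ?_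
  · exact (contDiff_const.mul ((hE b le_rfl).sub (hE b' le_rfl))).add (contDiff_polynomial_eval Q)
  · have hn : (((d + 1 : ℕ) : ℕ∞) : WithTop ℕ∞) ≤ (⊤ : ℕ∞) := by
      exact_mod_cast (le_top : ((d + 1 : ℕ) : ℕ∞) ≤ ⊤)
    have e1 : iteratedDeriv (d + 1)
        (fun x => c * (Real.exp (b * G x) - Real.exp (b' * G x)) + Q.eval x) x =
        c * (iteratedDeriv (d + 1) (fun x => Real.exp (b * G x)) x -
          iteratedDeriv (d + 1) (fun x => Real.exp (b' * G x)) x) := by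
      rw [iteratedDeriv_fun_add
        (contDiff_const.mul ((hE b hn).sub (hE b' hn))).contDiffAt
        (contDiff_polynomial_eval Q).contDiffAt, iteratedDeriv_polynomial_eval,
        iterate_derivative_eq_zero (Nat.lt_succ_of_le hQ)]
      simp only [eval_zero, add_zero]
      rw [iteratedDeriv_const_mul_field,
        iteratedDeriv_fun_sub (hE b hn).contDiffAt (hE b' hn).contDiffAt]
    rw [e1, abs_mul]
    exact (hB b b' hb hb' x hx).trans (le_mul_of_one_le_left (abs_nonneg _) hc)

/-! ### Phase differences, scattered sequences and the main theorem. -/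

theorem le_mul_truncKernel {T A C δ t : ℝ} (ht : 0 ≤ t) (hA : 0 ≤ A) (hC : 0 ≤ C) (h1 : T ≤ A)
    (h2 : t ≠ 0 → T ≤ C * t ^ (-δ)) : T ≤ (A + C) * truncKernel δ t := by
  unfold truncKernel
  split_ifs with h
  · linarith
  · have h3 := h2 h
    have h4 : 0 ≤ t ^ (-δ) := Real.rpow_nonneg ht _
    rcases min_choice (t ^ (-δ)) 1 with h5 | h5 <;> rw [h5] <;> nlinarith

theorem exp_mul_conj_exp (s t : ℝ) :
    Complex.exp (Complex.I * (s : ℂ)) * (starRingEnd ℂ) (Complex.exp (Complex.I * (t : ℂ))) =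
      Complex.exp (Complex.I * ((s - t : ℝ) : ℂ)) := by
  rw [← Complex.exp_conj, ← Complex.exp_add, map_mul, Complex.conj_I, Complex.conj_ofReal]
  congr 1
  push_cast
  ring

theorem ae_tendsto_average_exp {α β : ℝ} (hαβ : α ≤ β) {φ : ℕ → ℝ → ℝ}
    (hφ : ∀ n, Continuous (φ n)) {s : ℕ → ℝ} {δ C : ℝ} (hs : DeltaScattered δ s) (hC : 0 ≤ C)
    (n₀ : ℕ) (h : ∀ n m, n₀ ≤ m → m < n → s n ≠ s m →
      ‖∫ x in α..β, Complex.exp (Complex.I * ((φ n x - φ m x : ℝ) : ℂ))‖ ≤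
        C * |s n - s m| ^ (-δ)) :
    ∀ᵐ x ∂(volume.restrict (Set.Ioc α β)), Tendsto (fun N : ℕ =>
      (∑ n ∈ Finset.Icc 1 N, Complex.exp (Complex.I * (φ n x : ℂ))) / (N : ℂ)) atTop (𝓝 0) := by
  refine ae_tendsto_average_of_scattered (e := fun n x => Complex.exp (Complex.I * (φ n x : ℂ)))
    (fun n => ?_) (fun n x => (norm_exp_I_mul_ofReal _).le) hs
    (add_nonneg (sub_nonneg.2 hαβ) hC) n₀ fun n m hm hmn => ?_
  · have := hφ n
    exact Continuous.aestronglyMeasurable (by fun_prop)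
  · simp_rw [exp_mul_conj_exp]
    rw [← intervalIntegral.integral_of_le hαβ]
    refine le_mul_truncKernel (abs_nonneg _) (sub_nonneg.2 hαβ) hC
      (norm_integral_exp_le_length _ hαβ) fun hne => ?_
    exact h n m hm hmn (sub_ne_zero.1 (abs_ne_zero.1 hne))

/-- Under joint scattering, the coefficient of degree `natDegree (p i)`, with `c i ≠ 0`, is itself
the difference of a nontrivial combination of the `a l`. Under linear independence, the nonconstant
coefficients determine the vector of multipliers, so `s = a i` suffices. -/
theorem exists_scattered_le_abs_coeff {k : ℕ} {p : Fin k → ℝ[X]} (hp : ∀ i, 0 < (p i).natDegree)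
    {a : Fin k → ℕ → ℝ} (ha : ∀ i, Scattered (a i))
    (h : JointlyScattered a ∨ LinearIndependent ℝ (Fin.cons 1 p : Fin (k + 1) → ℝ[X]))
    {d : ℕ} (hd : ∀ i, (p i).natDegree ≤ d) {c : Fin k → ℝ} (hc : c ≠ 0) :
    ∃ s : ℕ → ℝ, Scattered s ∧ ∃ κ : ℝ, 0 < κ ∧ ∀ n m, s n ≠ s m → ∃ j ∈ Finset.Icc 1 d,
      κ * |s n - s m| ≤ |(∑ i, C (c i * (a i n - a i m)) * p i).coeff j| := by
  obtain ⟨i, hi⟩ := Function.ne_iff.1 hc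
  rw [Pi.zero_apply] at hi
  rcases h with h | h
  · set j := (p i).natDegree with hj
    refine ⟨fun n => ∑ l, (c l * (p l).coeff j) * a l n, h _ fun h0 => ?_, 1, one_pos,
      fun n m _ => ⟨j, Finset.mem_Icc.2 ⟨hp i, hd i⟩, le_of_eq ?_⟩⟩
    · have h1 := congrFun h0 i
      simp only [Pi.zero_apply, mul_eq_zero, hi, false_or] at h1
      have h2 : p i ≠ 0 := fun h => by have := hp i; rw [h] at this; simp at this
      exact h2 (leadingCoeff_eq_zero.1 h1)
    · rw [one_mul, finsetSum_coeff, ← Finset.sum_sub_distrib]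
      congr 1
      refine Finset.sum_congr rfl fun l _ => ?_
      rw [coeff_C_mul]
      ring
  -- The map sends multipliers to the coefficients of degrees `1` to `d`. Independence from `1`
  -- makes it injective although the constant term is dropped, and in finite dimension injectivity
  -- gives a lower bound on norms.
  · let T : (Fin k → ℝ) →ₗ[ℝ] (Fin d → ℝ) :=
      { toFun := fun v j => ∑ l, v l * (p l).coeff (j + 1)
        map_add' := fun v w => by
          ext j; simp only [Pi.add_apply, add_mul, Finset.sum_add_distrib]
        map_smul' := fun r v => by
          ext j; simp only [Pi.smul_apply, smul_eq_mul, Finset.mul_sum, mul_assoc, RingHom.id_apply] }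
    have hT : ∀ v j, T v j = (∑ l, C (v l) * p l).coeff (j + 1) := fun v j => by
      simp [T]
    have hker : LinearMap.ker T = ⊥ := by
      rw [LinearMap.ker_eq_bot']
      intro v hv
      set Q := ∑ l, C (v l) * p l with hQ
      have hQd : Q.natDegree ≤ d := natDegree_sum_le_of_forall_le _ _ fun l _ =>
        (natDegree_C_mul_le _ _).trans (hd l)
      have hQc : Q = C (Q.coeff 0) := by
        ext j
        rw [coeff_C]
        split_ifs with h0
        · rw [h0]
        · obtain ⟨j, rfl⟩ := Nat.exists_eq_succ_of_ne_zero h0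
          by_cases hjd : j < d
          · have := hT v ⟨j, hjd⟩
            rw [hv] at this
            exact this.symm
          · exact coeff_eq_zero_of_natDegree_lt (by omega)
      have h1 := Fintype.linearIndependent_iff.1 h (Fin.cons (-Q.coeff 0) v) (by
        rw [Fin.sum_univ_succ]
        simp only [Fin.cons_zero, Fin.cons_succ, smul_eq_C_mul, ← hQ]
        nth_rewrite 2 [hQc]
        simp)
      ext l
      simpa using h1 l.succ
    obtain ⟨K, hK0, hK⟩ := T.exists_antilipschitzWith hker
    have hK0' : (0 : ℝ) < K := hK0
    refine ⟨a i, ha i, |c i| / K, by positivity, fun n m hnm => ?_⟩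
    have hpos : 0 < |c i| / K * |a i n - a i m| := by
      have := abs_pos.2 (sub_ne_zero.2 hnm); positivity
    by_contra! hcon
    set v : Fin k → ℝ := fun l => c l * (a l n - a l m) with hv
    have h1 : ‖T v‖ < |c i| / K * |a i n - a i m| := by
      rw [pi_norm_lt_iff hpos]
      intro j
      rw [hT]
      exact hcon _ (Finset.mem_Icc.2 ⟨by omega, by omega⟩)
    have h2 : ‖v‖ ≤ K * ‖T v‖ := by
      have := hK.le_mul_dist v 0
      simpa [dist_eq_norm] using this
    have h3 : |c i| * |a i n - a i m| ≤ ‖v‖ := by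
      rw [← abs_mul]; exact norm_le_pi_norm v i
    have h4 : (K : ℝ) * (|c i| / K * |a i n - a i m|) = |c i| * |a i n - a i m| := by
      field_simp
    have h5 := mul_lt_mul_of_pos_left h1 hK0'
    linarith

/-- Zeros of `g'` are isolated: an accumulation point would force `g' = 0` everywhere and `g`
constant. -/
theorem volume_setOf_deriv_eq_zero {g : ℝ → ℝ} (hg : ∀ x, AnalyticAt ℝ g x)
    (hc : ¬ ∃ c : ℝ, ∀ x, g x = c) : volume {x | deriv g x = 0} = 0 := by
  refine measure_null_of_locally_null _ fun x₀ _ => ⟨{x₀}, ?_, Real.volume_singleton⟩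
  have hev : ∀ᶠ x in 𝓝[≠] x₀, deriv g x ≠ 0 := by
    by_contra hfr
    have h1 : ∃ᶠ x in 𝓝[≠] x₀, deriv g x = 0 := by
      simpa [Filter.not_eventually] using hfr
    have hA : AnalyticOnNhd ℝ (deriv g) Set.univ := fun x _ => (hg x).deriv
    have h2 := hA.eqOn_zero_of_preconnected_of_frequently_eq_zero isPreconnected_univ
      (Set.mem_univ x₀) h1
    exact hc ⟨g 0, fun x => is_const_of_deriv_eq_zero (fun y => (hg y).differentiableAt)
      (fun y => h2 (Set.mem_univ y)) x 0⟩
  rw [eventually_nhdsWithin_iff] at hev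
  rw [mem_nhdsWithin_iff_eventually]
  filter_upwards [hev] with x hx hx0
  by_contra hne
  exact hx hne hx0

/-- The exponential averages tend to zero almost everywhere near a non-critical point of `g`. -/
theorem exists_mem_nhds_ae_tendsto_average
    {g : ℝ → ℝ} (hg_gt : ∀ x, 1 < g x) (hg_an : ∀ x, AnalyticAt ℝ g x)
    {b : ℕ → ℝ} (hb_tendsto : Tendsto b atTop atTop) (hb : Scattered b)
    {k : ℕ} {p : Fin k → ℝ[X]} (hp : ∀ i, 0 < (p i).natDegree)
    {a : Fin k → ℕ → ℝ} (ha : ∀ i, Scattered (a i))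
    (h : JointlyScattered a ∨ LinearIndependent ℝ (Fin.cons 1 p : Fin (k + 1) → ℝ[X]))
    {m : Fin (k + 1) → ℤ} (hm : m ≠ 0) {x₀ : ℝ} (hx₀ : deriv g x₀ ≠ 0) :
    ∃ u ∈ 𝓝 x₀, MeasurableSet u ∧ ∀ᵐ x ∂(volume.restrict u), Tendsto (fun N : ℕ =>
      (∑ n ∈ Finset.Icc 1 N, Complex.exp (Complex.I * ((2 * Real.pi * ∑ i, (m i : ℝ) *
        (Fin.cons (g x ^ b n) (fun i => a i n * (p i).eval x) : Fin (k + 1) → ℝ) i : ℝ) : ℂ))) /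
          (N : ℂ)) atTop (𝓝 0) := by
  set G : ℝ → ℝ := fun x => Real.log (g x) with hG
  have hg0 : ∀ x, 0 < g x := fun x => one_pos.trans (hg_gt x)
  have hgs : ContDiff ℝ (⊤ : ℕ∞) g := contDiff_iff_contDiffAt.2 fun x => (hg_an x).contDiffAt
  have hGs : ContDiff ℝ (⊤ : ℕ∞) G := hgs.log fun x => (hg0 x).ne'
  have hG0 : 0 < G x₀ := Real.log_pos (hg_gt x₀)
  have hG1 : 0 < |deriv G x₀| := by
    rw [hG, deriv.log (hg_an x₀).differentiableAt (hg0 x₀).ne']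
    exact abs_pos.2 (div_ne_zero hx₀ (hg0 x₀).ne')
  have hnhds : ∀ᶠ x in 𝓝 x₀, G x₀ / 2 < G x ∧ |deriv G x₀| / 2 < |deriv G x| :=
    (hGs.continuous.continuousAt.eventually_const_lt (by linarith)).and
      ((contDiff_infty_iff_deriv.1 hGs).2.continuous.abs.continuousAt.eventually_const_lt
        (by linarith))
  obtain ⟨η, hη, hball⟩ := Metric.nhds_basis_closedBall.eventually_iff.1 hnhds
  rw [Real.closedBall_eq_Icc] at hball
  set α := x₀ - η with hα
  set β := x₀ + η with hβ
  have hαβ : α ≤ β := by linarith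
  refine ⟨Set.Ioc α β, Ioc_mem_nhds (by linarith) (by linarith), measurableSet_Ioc, ?_⟩
  -- The summand `1` gives `d ≥ 1` even when there are no polynomials.
  set d : ℕ := 1 + ∑ i, (p i).natDegree with hd
  have hd1 : 1 ≤ d := by omega
  have hpd : ∀ i, (p i).natDegree ≤ d := fun i =>
    (Finset.single_le_sum (f := fun i => (p i).natDegree) (fun _ _ => Nat.zero_le _)
      (Finset.mem_univ i)).trans (Nat.le_add_left _ _)
  set c : Fin k → ℝ := fun i => 2 * Real.pi * (m i.succ : ℝ) with hc
  set φ : ℕ → ℝ → ℝ := fun n x => 2 * Real.pi * (m 0 : ℝ) * Real.exp (b n * G x) +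
    (∑ i, C (c i * a i n) * p i).eval x with hφ
  have hφc : ∀ n, Continuous (φ n) := fun n =>
    (continuous_const.mul (Real.continuous_exp.comp (continuous_const.mul hGs.continuous))).add
      (Polynomial.continuous _)
  have hphase : ∀ n x, 2 * Real.pi * ∑ i, (m i : ℝ) *
      (Fin.cons (g x ^ b n) (fun i => a i n * (p i).eval x) : Fin (k + 1) → ℝ) i = φ n x := by
    intro n x
    rw [Fin.sum_univ_succ, mul_add, Finset.mul_sum]
    simp only [Fin.cons_zero, Fin.cons_succ, hφ, eval_finsetSum, eval_mul, eval_C, hc]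
    rw [Real.rpow_def_of_pos (hg0 x), mul_comm (Real.log (g x))]
    congr 1
    · ring
    · exact Finset.sum_congr rfl fun i _ => by ring
  simp_rw [hphase]
  have hdiff : ∀ n l x, φ n x - φ l x = 2 * Real.pi * (m 0 : ℝ) *
      (Real.exp (b n * G x) - Real.exp (b l * G x)) +
        (∑ i, C (c i * (a i n - a i l)) * p i).eval x := by
    intro n l x
    have : (∑ i, C (c i * (a i n - a i l)) * p i).eval x =
        (∑ i, C (c i * a i n) * p i).eval x - (∑ i, C (c i * a i l) * p i).eval x := by
      simp only [eval_finsetSum, eval_mul, eval_C, ← Finset.sum_sub_distrib]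
      exact Finset.sum_congr rfl fun i _ => by ring
    rw [this]
    simp only [hφ]
    ring
  have hQd : ∀ n l, (∑ i, C (c i * (a i n - a i l)) * p i).natDegree ≤ d := fun n l =>
    natDegree_sum_le_of_forall_le _ _ fun i _ => (natDegree_C_mul_le _ _).trans (hpd i)
  -- Without the exponential coordinate some other frequency is nonzero and the polynomials must
  -- supply the oscillation. With it, the polynomial part plays no role beyond its degree.
  by_cases hm0 : m 0 = 0
  · have hc0 : c ≠ 0 := by
      intro h0
      refine hm (funext fun i => ?_)
      refine Fin.cases hm0 (fun i => ?_) i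
      have := congrFun h0 i
      simp only [hc, Pi.zero_apply, mul_eq_zero, Real.pi_ne_zero, Int.cast_eq_zero,
        OfNat.ofNat_ne_zero, false_or] at this
      exact this
    obtain ⟨s, hs, κ, hκ, hcoef⟩ := exists_scattered_le_abs_coeff hp ha h hpd hc0
    obtain ⟨C₀, hC₀, hint⟩ := exists_norm_integral_exp_polynomial_le hd1
      (R := |x₀| + η + 1) (by have := abs_nonneg x₀; linarith)
    refine ae_tendsto_average_exp hαβ hφc (hs (1 / d) ⟨by positivity, ?_⟩)
      (C := C₀ * κ ^ (-(1 / d : ℝ))) (by positivity) 0 fun n l _ _ hne => ?_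
    · exact (div_le_one (by positivity)).2 (by exact_mod_cast hd1)
    · simp_rw [hdiff, hm0]
      simp only [Int.cast_zero, mul_zero, zero_mul, zero_add]
      have hpos := abs_pos.2 (sub_ne_zero.2 hne)
      have := hint _ (κ * |s n - s l|) α β (hQd n l) (by positivity) (hcoef n l hne)
        (by have := neg_abs_le x₀; linarith) hαβ (by have := le_abs_self x₀; linarith)
      rwa [Real.mul_rpow hκ.le hpos.le, ← mul_assoc, neg_div] at this
  · obtain ⟨B, C₀, hC₀, hint⟩ := exists_norm_integral_exp_exp_sub_le hGs hαβ
      (half_pos hG0) (half_pos hG1) (fun x hx => (hball hx).1.le) (fun x hx => (hball hx).2.le) hd1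
    -- Derivatives of the exponentials are separated only for exponents at least `B`; since `b`
    -- tends to infinity, this excludes finitely many indices.
    obtain ⟨n₀, hn₀⟩ := eventually_atTop.1 (hb_tendsto.eventually_ge_atTop B)
    refine ae_tendsto_average_exp hαβ hφc (hb (1 / (d + 1 : ℕ)) ⟨by positivity, ?_⟩) hC₀ n₀
      fun n l hl hln hne => ?_
    · exact (div_le_one (by positivity)).2 (by exact_mod_cast Nat.le_add_left 1 d)
    · simp_rw [hdiff]
      have := hint (b n) (b l) (2 * Real.pi * (m 0 : ℝ)) _ (hn₀ n (by omega)) (hn₀ l hl) hne ?_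
        (hQd n l)
      · rwa [neg_div] at this
      · rw [abs_mul, abs_of_pos (by positivity : 0 < 2 * Real.pi)]
        have h1 : (1 : ℝ) ≤ |(m 0 : ℝ)| := by exact_mod_cast Int.one_le_abs hm0
        have h2 := Real.pi_gt_three
        nlinarith

theorem mainTheorem5
    (g : ℝ → ℝ) (hg_gt : ∀ x, 1 < g x) (hg_an : ∀ x, AnalyticAt ℝ g x)
    (hg_nonconst : ¬ ∃ c : ℝ, ∀ x, g x = c)
    (b : ℕ → ℝ) (hb_tendsto : Tendsto b atTop atTop) (hb : Scattered b)
    (k : ℕ) (hk : 1 ≤ k)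
    (p : Fin k → ℝ[X]) (hp : ∀ i, 0 < (p i).natDegree)
    (a : Fin k → ℕ → ℝ) (ha : ∀ i, Scattered (a i))
    (h : JointlyScattered a ∨
      LinearIndependent ℝ (Fin.cons 1 p : Fin (k + 1) → ℝ[X])) :
    ∀ᵐ x ∂(volume : Measure ℝ),
      UniformlyDistributedModOne
        (fun n => (Fin.cons (g x ^ b n) (fun i => a i n * (p i).eval x) : Fin (k + 1) → ℝ)) := by
  have hae : ∀ m : Fin (k + 1) → ℤ, m ≠ 0 → ∀ᵐ x ∂(volume : Measure ℝ), Tendsto (fun N : ℕ =>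
      (∑ n ∈ Finset.Icc 1 N, Complex.exp (Complex.I * ((2 * Real.pi * ∑ i, (m i : ℝ) *
        (Fin.cons (g x ^ b n) (fun i => a i n * (p i).eval x) : Fin (k + 1) → ℝ) i : ℝ) : ℂ))) /
          (N : ℂ)) atTop (𝓝 0) := by
    intro m hm
    -- The bad set is split along the critical points of `g`: they are null, and near any other
    -- point the local result applies.
    rw [ae_iff, ← measure_inter_add_sdiff₀ _ (measurableSet_eq_fun
      (measurable_deriv g) measurable_const : MeasurableSet {x | deriv g x = 0}).nullMeasurableSet,
      measure_mono_null Set.inter_subset_right (volume_setOf_deriv_eq_zero hg_an hg_nonconst),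
      zero_add]
    refine measure_null_of_locally_null _ fun x₀ hx₀ => ?_
    obtain ⟨u, hu, hum, hae⟩ := exists_mem_nhds_ae_tendsto_average hg_gt hg_an hb_tendsto hb hp ha h
      hm hx₀.2
    rw [ae_restrict_iff' hum, ae_iff] at hae
    refine ⟨_, ?_, hae⟩
    filter_upwards [mem_nhdsWithin_of_mem_nhds hu, self_mem_nhdsWithin] with x hxu hx
    exact fun hcon => hx.1 (hcon hxu)
  filter_upwards [ae_all_iff.2 fun m => eventually_imp_distrib_left.2 (hae m)] with x hx
  exact uniformlyDistributedModOne_of_weyl fun m hm => hx m hm
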